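/- Let $d\ge 1$, let $\Omega\subset\mathbb{R}^d$ be a bounded Lipschitz domain and let $f\in L^2(\Omega)$. Let $K,R:[0,\infty)\to[0,\infty)$ be $C^1$, monotonically decreasing kernels, neither of them identically zero, with $\operatorname{supp}K\subset[0,r_K^2/4]$ and $\operatorname{supp}R\subset[0,r_R^2/4]$ for some constants $r_K,r_R>0$, and put $\bar R(x)=\int_x^\infty R(s)\,ds$ for $x\ge 0$. For $\delta>0$ write $K_\delta(x,y)=\delta^{-d}K\bigl(\tfrac{|x-y|^2}{4\delta^2}\bigr)$, and define $R_\delta,\bar R_\delta$ likewise. Let $(\delta_n)$ and $(\xi_n)$ be sequences of positive numbers tending to $0$. For boundary data $a,b$ on $\partial\Omega$ and $u\in L^2(\Omega)$ let $$F_n(u;a,b,f)=\int_\Omega\Bigl|\frac1{\delta_n^2}\int_\Omega R_{\delta_n}(x,y)\,(u(x)-u(y))\,dy-2\int_{\partial\Omega}\bar R_{\delta_n}(x,y)\,b(y)\,dS(y)\Bigr|^2dx-2\int_\Omega f u\,dx+\frac1{\xi_n}\int_{\partial\Omega}\Bigl|\int_\Omega K_{\delta_n}(x,y)\,(a(x)-u(y))\,dy\Bigr|^2dS(x).$$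 Consider the homogeneous boundary data $a\equiv 0$, $b\equiv 0$. Then there is a constant $C>0$, not depending on $n$, such that for every $n$ every minimizer $u_n^*$ of $F_n(\,\cdot\,;0,0,f):L^2(\Omega)\to\mathbb{R}$ satisfies $$\|u_n^*\|_{L^2(\Omega)}\le C .$$ -/

import Mathlib

open MeasureTheory Filter Topology Set

/-- A bounded Lipschitz domain: a bounded, open, connected (in particular non-empty) set which, near
each of its boundary points and after the choice of a unit vector `e` as the vertical direction, is
the part of space strictly above the graph of a Lipschitz function `γ` on the hyperplane
orthogonal to `e`. -/
structure IsBoundedLipschitzDomain {d : ℕ} (Ω : Set (EuclideanSpace ℝ (Fin d))) : Prop where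
  isOpen : IsOpen Ω
  isConnected : IsConnected Ω
  isBounded : Bornology.IsBounded Ω
  lipschitz_boundary : ∀ x₀ ∈ frontier Ω,
    ∃ r > 0, ∃ e : EuclideanSpace ℝ (Fin d), ‖e‖ = 1 ∧
      ∃ (L : NNReal) (γ : (Submodule.span ℝ {e})ᗮ → ℝ), LipschitzWith L γ ∧
        ∀ x ∈ Metric.ball x₀ r,
          (x ∈ Ω ↔ γ ((Submodule.span ℝ {e})ᗮ.orthogonalProjectionOnto x) < inner ℝ e x)

/-- The assumptions on a one-dimensional kernel `K : [0, ∞) → [0, ∞)`, represented by a function on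
`ℝ` whose values at negative arguments play no role. -/
structure IsKernel (K : ℝ → ℝ) (r : ℝ) : Prop where
  contDiffOn : ContDiffOn ℝ 1 K (Ici 0)
  nonneg : ∀ s, 0 ≤ s → 0 ≤ K s
  antitoneOn : AntitoneOn K (Ici 0)
  eq_zero : ∀ s, r ^ 2 / 4 < s → K s = 0

noncomputable section

/-- The integrated kernel `R̄(x) = ∫_x^∞ R(s) ds`. -/
def kernelTail (R : ℝ → ℝ) (x : ℝ) : ℝ := ∫ s in Ioi x, R s

/-- The scaled kernel `K_δ(x, y) = δ^{-d} K(|x - y|² / (4 δ²))`. -/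
def scaledKernel {d : ℕ} (K : ℝ → ℝ) (δ : ℝ) (x y : EuclideanSpace ℝ (Fin d)) : ℝ :=
  1 / δ ^ d * K (‖x - y‖ ^ 2 / (4 * δ ^ 2))

/-- The surface measure on `∂Ω`: the `(d-1)`-dimensional Hausdorff measure, normalized so as to agree
with Lebesgue measure on hyperplanes. -/
def surfaceMeasure {d : ℕ} (Ω : Set (EuclideanSpace ℝ (Fin d))) :
    Measure (EuclideanSpace ℝ (Fin d)) :=
  (Measure.euclideanHausdorffMeasure (d - 1)).restrict (frontier Ω)

/-- The interior residual
`I(u)(x) = δ^{-2} ∫_Ω R_δ(x, y) (u(x) - u(y)) dy - 2 ∫_{∂Ω} R̄_δ(x, y) b(y) dS(y)`. -/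
def interiorResidual {d : ℕ} (Ω : Set (EuclideanSpace ℝ (Fin d))) (R : ℝ → ℝ) (δ : ℝ)
    (b u : EuclideanSpace ℝ (Fin d) → ℝ) (x : EuclideanSpace ℝ (Fin d)) : ℝ :=
  1 / δ ^ 2 * (∫ y in Ω, scaledKernel R δ x y * (u x - u y)) -
    2 * ∫ y, scaledKernel (kernelTail R) δ x y * b y ∂(surfaceMeasure Ω)

/-- The penalty term for the Dirichlet boundary condition,
`B(u, a) = ξ⁻¹ ∫_{∂Ω} |∫_Ω K_δ(x, y) (a(x) - u(y)) dy|² dS(x)`. -/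
def boundaryPenalty {d : ℕ} (Ω : Set (EuclideanSpace ℝ (Fin d))) (K : ℝ → ℝ) (δ ξ : ℝ)
    (a u : EuclideanSpace ℝ (Fin d) → ℝ) : ℝ :=
  1 / ξ * ∫ x, |∫ y in Ω, scaledKernel K δ x y * (a x - u y)| ^ 2 ∂(surfaceMeasure Ω)

/-- The nonlocal energy
`F(u; a, b, f) = ∫_Ω |I(u)|² dx - 2 ∫_Ω f u dx + B(u, a)` on `L²(Ω)`. -/
def nonlocalEnergy {d : ℕ} (Ω : Set (EuclideanSpace ℝ (Fin d))) (K R : ℝ → ℝ) (δ ξ : ℝ)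
    (a b : EuclideanSpace ℝ (Fin d) → ℝ) (f u : Lp ℝ 2 (volume.restrict Ω)) : ℝ :=
  (∫ x in Ω, |interiorResidual Ω R δ b u x| ^ 2) - 2 * (∫ x in Ω, f x * u x) +
    boundaryPenalty Ω K δ ξ a u

end

/-! A minimizer `u` has energy at most that of `0`, which is zero. Hence V = ∫_Ω |I(u)|² and S/ξ,
where S = ∫_∂Ω |∫_Ω K_δ u|², are both at most 2‖f‖‖u‖. Everything rests on a coercivity estimate
‖u‖² ≤ C (G + S), where G is the nonlocal Dirichlet energy `rangeEnergy` at range σδ. Symmetrizing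
the double integral gives 2δ² ∫ I(u) u = ∬ R_δ |u(x) - u(y)|², and R is bounded below near 0, so G ≤
A ∫ I(u) u with A independent of δ. Young's inequality then absorbs half of ‖u‖² and leaves ‖u‖² ≤
(CA)² V + 2 C S, which is at most a constant times ‖f‖‖u‖ (`norm_le_of_isMinOn`).

Coercivity has to be uniform as δ → 0 (`exists_uniform_coercivity`), and two mechanisms give this.
Translating by a fixed vector in N ~ |v|/ε steps costs ε² G per step, and Cauchy–Schwarz along the
path multiplies this by N², so the total stays bounded. Control of u on one ball therefore spreads
through the connected set Ω and, along interior cones, up to the boundary (`controlledOn_univ`).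

Control on one ball comes from the boundary term (`exists_ball_control`). In a slab above a boundary
patch, u is compared along vertical segments with its kernel average at the foot. Integrating
averages over δ-balls against the surface loses a factor δ^{-d} δ^{d-1} = 1/δ. The loss is recovered
because the successive vertical translates of a strip of thickness ~δ overlap only boundedly often
(`lintegral_sqDiff_strip_le`).

The finitely many n with δ_n or ξ_n not small may each have their own constant. It comes from a
Poincaré inequality at fixed range (`exists_poincare`) and the positivity of the kernel mass on ∂Ω
(`exists_coercivity`). -/

noncomputable section

open scoped ENNReal NNReal

variable {d : ℕ} {Ω : Set (EuclideanSpace ℝ (Fin d))}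

/-! ### Squared differences and the nonlocal Dirichlet energy -/

/-- The squared difference `|u x - u y|²` as an extended nonnegative real. -/
def sqDiff {α : Type*} (u : α → ℝ) (x y : α) : ℝ≥0∞ := ENNReal.ofReal ((u x - u y) ^ 2)

lemma sqDiff_comm {α : Type*} (u : α → ℝ) (x y : α) : sqDiff u x y = sqDiff u y x := by
  unfold sqDiff; congr 1; ring

lemma sqDiff_triangle {α : Type*} (u : α → ℝ) (x y z : α) :
    sqDiff u x z ≤ 2 * sqDiff u x y + 2 * sqDiff u y z := by
  unfold sqDiff
  rw [← mul_add, ← ENNReal.ofReal_add (sq_nonneg _) (sq_nonneg _),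
    show (2 : ℝ≥0∞) = ENNReal.ofReal 2 by simp, ← ENNReal.ofReal_mul (by norm_num)]
  apply ENNReal.ofReal_le_ofReal
  nlinarith [sq_nonneg (u x - u y - (u y - u z))]

lemma ofReal_sq_le_sqDiff {α : Type*} (u : α → ℝ) (x y : α) :
    ENNReal.ofReal (u x ^ 2) ≤ 2 * sqDiff u x y + 2 * ENNReal.ofReal (u y ^ 2) := by
  unfold sqDiff
  rw [← mul_add, ← ENNReal.ofReal_add (sq_nonneg _) (sq_nonneg _),
    show (2 : ℝ≥0∞) = ENNReal.ofReal 2 by simp, ← ENNReal.ofReal_mul (by norm_num)]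
  apply ENNReal.ofReal_le_ofReal
  nlinarith [sq_nonneg (u x - u y - u y)]

lemma measurable_sqDiff {α β : Type*} [MeasurableSpace α] [MeasurableSpace β] {u : α → ℝ}
    (hu : Measurable u) {f g : β → α} (hf : Measurable f) (hg : Measurable g) :
    Measurable fun b => sqDiff u (f b) (g b) :=
  (((hu.comp hf).sub (hu.comp hg)).pow_const 2).ennreal_ofReal

/-- Telescoping along the path, then Cauchy–Schwarz. The factor N here, together with the N
summands, gives the N² that must be balanced by ε² per step. -/
lemma sqDiff_add_nsmul_le {α : Type*} [AddCommGroup α] (u : α → ℝ) (x h : α) (N : ℕ) :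
    sqDiff u x (x + N • h) ≤
      N * ∑ j ∈ Finset.range N, sqDiff u (x + j • h) (x + j • h + h) := by
  unfold sqDiff
  rw [← ENNReal.ofReal_sum_of_nonneg (fun _ _ => sq_nonneg _), ← ENNReal.ofReal_natCast,
    ← ENNReal.ofReal_mul (by positivity)]
  apply ENNReal.ofReal_le_ofReal
  have key : u (x + N • h) - u x
      = ∑ j ∈ Finset.range N, (u (x + j • h + h) - u (x + j • h)) := by
    have := Finset.sum_range_sub (fun j : ℕ => u (x + j • h)) N
    simp only [zero_smul, add_zero, succ_nsmul, ← add_assoc] at this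
    exact this.symm
  have h2 := sq_sum_le_card_mul_sum_sq (s := Finset.range N)
    (f := fun j : ℕ => u (x + j • h + h) - u (x + j • h))
  rw [← key, Finset.card_range] at h2
  calc (u x - u (x + N • h)) ^ 2 = (u (x + N • h) - u x) ^ 2 := by ring
    _ ≤ _ := h2
    _ = _ := by
      congr 1
      exact Finset.sum_congr rfl fun j _ => by ring

/-- The pairs of points of `Ω` at distance less than `ε`. -/
def nearPairs {d : ℕ} (Ω : Set (EuclideanSpace ℝ (Fin d))) (ε : ℝ) :
    Set (EuclideanSpace ℝ (Fin d) × EuclideanSpace ℝ (Fin d)) :=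
  {p | p.1 ∈ Ω ∧ p.2 ∈ Ω ∧ dist p.1 p.2 < ε}

/-- The nonlocal Dirichlet energy at interaction range `ε`. -/
def rangeEnergy {d : ℕ} (Ω : Set (EuclideanSpace ℝ (Fin d))) (ε : ℝ)
    (u : EuclideanSpace ℝ (Fin d) → ℝ) : ℝ≥0∞ :=
  ENNReal.ofReal (ε ^ (d + 2))⁻¹ *
    ∫⁻ p in nearPairs Ω ε, sqDiff u p.1 p.2 ∂(volume.prod volume)

lemma measurableSet_nearPairs (hΩ : IsOpen Ω) (ε : ℝ) : MeasurableSet (nearPairs Ω ε) := by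
  have h : nearPairs Ω ε = Prod.fst ⁻¹' Ω ∩ Prod.snd ⁻¹' Ω ∩ {p | dist p.1 p.2 < ε} := by
    ext; simp [nearPairs, and_assoc]
  rw [h]
  exact (((hΩ.preimage continuous_fst).inter (hΩ.preimage continuous_snd)).inter
    (isOpen_lt continuous_dist continuous_const)).measurableSet

/-! ### Translation estimates, uniform in the interaction range -/

lemma measurePreserving_shear (a b : EuclideanSpace ℝ (Fin d)) :
    MeasurePreserving (fun p : EuclideanSpace ℝ (Fin d) × EuclideanSpace ℝ (Fin d) =>
      (p.1 + a, p.1 + b + p.2)) (volume.prod volume) (volume.prod volume) := by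
  have h1 := measurePreserving_prod_add (volume : Measure (EuclideanSpace ℝ (Fin d)))
    (volume : Measure (EuclideanSpace ℝ (Fin d)))
  have h2 := (measurePreserving_add_right (volume : Measure (EuclideanSpace ℝ (Fin d))) a).prod
    (measurePreserving_add_right (volume : Measure (EuclideanSpace ℝ (Fin d))) b)
  convert h2.comp h1 using 1
  ext p : 1
  simp [Prod.map, add_right_comm]

/-- After the shear, a base point and an auxiliary point near it become an arbitrary pair of
`nearPairs`. It serves twice, to join each end of a step to the same auxiliary point. -/
lemma lintegral_sqDiff_shear_le (hΩ : IsOpen Ω) {ε : ℝ} {u : EuclideanSpace ℝ (Fin d) → ℝ}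
    (hu : Measurable u) {T : Set (EuclideanSpace ℝ (Fin d) × EuclideanSpace ℝ (Fin d))}
    (a b : EuclideanSpace ℝ (Fin d))
    (hT : ∀ p ∈ T, (p.1 + a, p.1 + b + p.2) ∈ nearPairs Ω ε) :
    ∫⁻ p in T, sqDiff u (p.1 + a) (p.1 + b + p.2) ∂(volume.prod volume) ≤
      ∫⁻ p in nearPairs Ω ε, sqDiff u p.1 p.2 ∂(volume.prod volume) := by
  rw [← (measurePreserving_shear a b).setLIntegral_comp_preimage (measurableSet_nearPairs hΩ ε)
    (measurable_sqDiff hu measurable_fst measurable_snd)]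
  exact lintegral_mono_set hT

/-- The constant in the one-step translation estimate. -/
def stepConst (d : ℕ) (c : ℝ) : ℝ≥0∞ :=
  4 * (volume (Metric.ball (0 : EuclideanSpace ℝ (Fin d)) (c / 4)))⁻¹

lemma stepConst_ne_top {c : ℝ} (hc : 0 < c) : stepConst d c ≠ ∞ := by
  unfold stepConst
  have : volume (Metric.ball (0 : EuclideanSpace ℝ (Fin d)) (c / 4)) ≠ 0 :=
    (Metric.measure_ball_pos _ _ (by positivity)).ne'
  finiteness

/-- One-step translation estimate. -/
lemma lintegral_sqDiff_step_le (hΩ : IsOpen Ω) {ε c : ℝ} (hε : 0 < ε) (hc : 0 < c) (hc1 : c ≤ 1)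
    {u : EuclideanSpace ℝ (Fin d) → ℝ} (hu : Measurable u) {A : Set (EuclideanSpace ℝ (Fin d))}
    {h q : EuclideanSpace ℝ (Fin d)} (hh : ‖h‖ ≤ ε / 2) (hq : ‖q‖ ≤ ε / 4)
    (hA : ∀ x ∈ A, x ∈ Ω ∧ x + h ∈ Ω ∧ Metric.ball (x + q) (c * ε / 4) ⊆ Ω) :
    ∫⁻ x in A, sqDiff u x (x + h) ≤ stepConst d c * ENNReal.ofReal (ε ^ 2) * rangeEnergy Ω ε u := by
  set B := Metric.ball (0 : EuclideanSpace ℝ (Fin d)) (c * ε / 4) with hB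
  set I := ∫⁻ p in nearPairs Ω ε, sqDiff u p.1 p.2 ∂(volume.prod volume) with hI
  -- The auxiliary point x + q + z has to be within ε of both x and x + h. The bounds ε/2, ε/4 and
  -- ε/4 on h, q and z add up to exactly ε, and the open ball makes the inequality strict.
  have hcε : c * ε / 4 ≤ ε / 4 := by nlinarith
  have hball : ∀ x ∈ A, ∀ z ∈ B, x + q + z ∈ Ω := fun x hx z hz => (hA x hx).2.2 (by
    simpa [hB] using hz)
  have h1 : ∫⁻ p in A ×ˢ B, sqDiff u p.1 (p.1 + q + p.2) ∂(volume.prod volume) ≤ I := by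
    have := lintegral_sqDiff_shear_le hΩ (ε := ε) hu (T := A ×ˢ B) 0 q (by
      rintro ⟨x, z⟩ ⟨hx, hz⟩
      refine ⟨by simpa using (hA x hx).1, hball x hx z hz, ?_⟩
      have hz' : ‖z‖ < c * ε / 4 := by simpa [hB] using hz
      rw [dist_eq_norm, show x + 0 - (x + q + z) = -(q + z) by abel, norm_neg]
      linarith [norm_add_le q z])
    simpa using this
  have h2 : ∫⁻ p in A ×ˢ B, sqDiff u (p.1 + h) (p.1 + q + p.2) ∂(volume.prod volume) ≤ I := by
    refine lintegral_sqDiff_shear_le hΩ (ε := ε) hu (T := A ×ˢ B) h q ?_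
    rintro ⟨x, z⟩ ⟨hx, hz⟩
    refine ⟨(hA x hx).2.1, hball x hx z hz, ?_⟩
    have hz' : ‖z‖ < c * ε / 4 := by simpa [hB] using hz
    rw [dist_eq_norm, show x + h - (x + q + z) = h - (q + z) by abel]
    linarith [norm_add_le q z, norm_sub_le h (q + z)]
  -- The increment over h is routed through x + q + z and averaged over z in B.
  have h3 : (∫⁻ x in A, sqDiff u x (x + h)) * volume B ≤ 4 * I := by
    calc (∫⁻ x in A, sqDiff u x (x + h)) * volume B
        = ∫⁻ p in A ×ˢ B, sqDiff u p.1 (p.1 + h) ∂(volume.prod volume) := by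
          rw [← Measure.prod_restrict, lintegral_prod _
            (measurable_sqDiff hu measurable_fst (by fun_prop)).aemeasurable]
          simp only [lintegral_const, Measure.restrict_apply_univ]
          rw [lintegral_mul_const]
          exact measurable_sqDiff hu measurable_id (measurable_id.add_const h)
      _ ≤ ∫⁻ p in A ×ˢ B, (2 * sqDiff u p.1 (p.1 + q + p.2) +
            2 * sqDiff u (p.1 + h) (p.1 + q + p.2)) ∂(volume.prod volume) := by
          refine lintegral_mono fun p => ?_
          rw [sqDiff_comm u (p.1 + h)]
          exact sqDiff_triangle _ _ _ _
      _ ≤ 2 * I + 2 * I := by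
          rw [lintegral_add_left ((measurable_sqDiff hu measurable_fst (by fun_prop)).const_mul 2),
            lintegral_const_mul _ (measurable_sqDiff hu measurable_fst (by fun_prop)),
            lintegral_const_mul _ (measurable_sqDiff hu (by fun_prop) (by fun_prop))]
          gcongr
      _ = 4 * I := by ring
  have hvol : volume B = ENNReal.ofReal (ε ^ d) *
      volume (Metric.ball (0 : EuclideanSpace ℝ (Fin d)) (c / 4)) := by
    have := Measure.addHaar_ball_mul_of_pos (volume : Measure (EuclideanSpace ℝ (Fin d))) 0 hε (c / 4)
    rw [finrank_euclideanSpace_fin] at this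
    rw [hB, ← this]; congr 2; ring
  have hV0 : volume B ≠ 0 := (Metric.measure_ball_pos _ _ (by positivity)).ne'
  have hVt : volume B ≠ ∞ := measure_ball_lt_top.ne
  have h4 : ∫⁻ x in A, sqDiff u x (x + h) ≤ 4 * I * (volume B)⁻¹ := by
    rw [← div_eq_mul_inv]; exact ENNReal.le_div_iff_mul_le (Or.inl hV0) (Or.inl hVt) |>.2 h3
  refine h4.trans_eq ?_
  -- Dividing by |B| ~ ε^d uses up all of the normalization ε^{-(d+2)} except ε².
  have hεd : ENNReal.ofReal (ε ^ 2) * ENNReal.ofReal (ε ^ (d + 2))⁻¹ = (ENNReal.ofReal (ε ^ d))⁻¹ := by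
    rw [← ENNReal.ofReal_mul (by positivity), ← ENNReal.ofReal_inv_of_pos (by positivity)]
    congr 1; field_simp; ring
  rw [hvol, ENNReal.mul_inv (Or.inr measure_ball_lt_top.ne) (Or.inl ENNReal.ofReal_ne_top), ← hεd]
  unfold stepConst rangeEnergy
  ring

/-- Translation by `N` steps of size `h`. -/
lemma lintegral_sqDiff_nsmul_le (hΩ : IsOpen Ω) {ε c : ℝ} (hε : 0 < ε) (hc : 0 < c) (hc1 : c ≤ 1)
    {u : EuclideanSpace ℝ (Fin d) → ℝ} (hu : Measurable u) {A : Set (EuclideanSpace ℝ (Fin d))}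
    {h q : EuclideanSpace ℝ (Fin d)} (hh : ‖h‖ ≤ ε / 2) (hq : ‖q‖ ≤ ε / 4) (N : ℕ)
    (hA : ∀ x ∈ A, ∀ j : ℕ, j ≤ N → x + j • h ∈ Ω ∧ Metric.ball (x + j • h + q) (c * ε / 4) ⊆ Ω) :
    ∫⁻ x in A, sqDiff u x (x + N • h) ≤
      N * N * (stepConst d c * ENNReal.ofReal (ε ^ 2) * rangeEnergy Ω ε u) := by
  calc ∫⁻ x in A, sqDiff u x (x + N • h)
      ≤ ∫⁻ x in A, N * ∑ j ∈ Finset.range N, sqDiff u (x + j • h) (x + j • h + h) :=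
        lintegral_mono fun x => sqDiff_add_nsmul_le u x h N
    _ = N * ∑ j ∈ Finset.range N, ∫⁻ x in A, sqDiff u (x + j • h) (x + j • h + h) := by
        rw [lintegral_const_mul, lintegral_finsetSum]
        · exact fun j _ => measurable_sqDiff hu (by fun_prop) (by fun_prop)
        · exact Finset.measurable_sum _ fun j _ => measurable_sqDiff hu (by fun_prop) (by fun_prop)
    _ ≤ N * ∑ j ∈ Finset.range N, (stepConst d c * ENNReal.ofReal (ε ^ 2) * rangeEnergy Ω ε u) := by
        gcongr with j hj
        have hj : j < N := Finset.mem_range.1 hj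
        have hmp := measurePreserving_add_right (volume : Measure (EuclideanSpace ℝ (Fin d))) (j • h)
        have hemb := (Homeomorph.addRight (j • h)).measurableEmbedding
        have : ∫⁻ x in A, sqDiff u (x + j • h) (x + j • h + h) =
            ∫⁻ y in (fun x => x + j • h) '' A, sqDiff u y (y + h) :=
          hmp.setLIntegral_comp_emb hemb (fun y => sqDiff u y (y + h)) A
        rw [this]
        refine lintegral_sqDiff_step_le hΩ hε hc hc1 hu hh hq ?_
        rintro _ ⟨x, hx, rfl⟩
        refine ⟨(hA x hx j hj.le).1, ?_, (hA x hx j hj.le).2⟩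
        have := (hA x hx (j + 1) hj).1
        rwa [succ_nsmul, ← add_assoc] at this
    _ = _ := by simp [mul_assoc]

/-- Translation estimate with a constant independent of the interaction range. -/
lemma lintegral_sqDiff_translate_le (hΩ : IsOpen Ω) {c τ : ℝ} (hc : 0 < c) (hc1 : c ≤ 1)
    {A : Set (EuclideanSpace ℝ (Fin d))} {v q : EuclideanSpace ℝ (Fin d)} (hq : ‖q‖ ≤ 1)
    (hA : ∀ x ∈ A, ∀ t ∈ Icc (0 : ℝ) 1, x + t • v ∈ Ω ∧
      ∀ s ∈ Ioo 0 τ, Metric.ball (x + t • v + s • q) (c * s) ⊆ Ω)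
    {ε : ℝ} (hε : 0 < ε) (hετ : ε < 4 * τ)
    {u : EuclideanSpace ℝ (Fin d) → ℝ} (hu : Measurable u) :
    ∫⁻ x in A, sqDiff u x (x + v) ≤
      stepConst d c * ENNReal.ofReal ((2 * ‖v‖ + 4 * τ) ^ 2) * rangeEnergy Ω ε u := by
  -- Just enough steps to make each at most ε/2; then Nε ≤ 2‖v‖ + ε, so N²ε² is bounded
  -- independently of ε.
  set N : ℕ := ⌊2 * ‖v‖ / ε⌋₊ + 1 with hN
  have hN0 : (0 : ℝ) < N := by positivity
  have hN1 : 2 * ‖v‖ / ε < N := by rw [hN]; push_cast; exact Nat.lt_floor_add_one _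
  have hN2 : (N : ℝ) * ε ≤ 2 * ‖v‖ + 4 * τ := by
    have : (⌊2 * ‖v‖ / ε⌋₊ : ℝ) * ε ≤ 2 * ‖v‖ := by
      rw [← le_div_iff₀ hε]; exact Nat.floor_le (by positivity)
    rw [hN]; push_cast; linarith
  have hNv : N • ((N : ℝ)⁻¹ • v) = v := by
    rw [← Nat.cast_smul_eq_nsmul ℝ, smul_smul, mul_inv_cancel₀ hN0.ne', one_smul]
  have key := lintegral_sqDiff_nsmul_le hΩ hε hc hc1 hu (A := A) (h := (N : ℝ)⁻¹ • v)
    (q := (ε / 4) • q) ?_ ?_ N ?_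
  · rw [hNv] at key
    refine key.trans ?_
    calc (N : ℝ≥0∞) * N * (stepConst d c * ENNReal.ofReal (ε ^ 2) * rangeEnergy Ω ε u)
        = stepConst d c * (ENNReal.ofReal ((N * ε) ^ 2)) * rangeEnergy Ω ε u := by
          rw [mul_pow, ENNReal.ofReal_mul (by positivity), ENNReal.ofReal_pow (p := (N : ℝ)) (by positivity),
            ENNReal.ofReal_natCast]; ring
      _ ≤ _ := by gcongr
  · rw [norm_smul, norm_inv, Real.norm_natCast, inv_mul_le_iff₀ hN0]
    rw [div_lt_iff₀ hε] at hN1; linarith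
  · rw [norm_smul, Real.norm_of_nonneg (by positivity)]; nlinarith
  · intro x hx j hj
    have hj' : j • ((N : ℝ)⁻¹ • v) = ((j : ℝ) / N) • v := by
      rw [← Nat.cast_smul_eq_nsmul ℝ, smul_smul, div_eq_mul_inv]
    have ht : (j : ℝ) / N ∈ Icc (0 : ℝ) 1 :=
      ⟨by positivity, by rw [div_le_one hN0]; exact_mod_cast hj⟩
    rw [hj']
    refine ⟨(hA x hx _ ht).1, ?_⟩
    -- The cone is used at s = ε/4, which is why ε < 4τ is required.
    have := (hA x hx _ ht).2 (ε / 4) ⟨by positivity, by linarith⟩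
    rwa [← mul_div_assoc] at this

/-! ### Sets on which the L² norm is controlled -/

/-- `∫_{Ω ∩ S} u²` is controlled by the nonlocal energy and `∫_B u²`, uniformly for small
interaction range. -/
def ControlledOn (Ω B S : Set (EuclideanSpace ℝ (Fin d))) : Prop :=
  ∃ C : ℝ≥0∞, C ≠ ∞ ∧ ∃ ε₀ > 0, ∀ ε, 0 < ε → ε < ε₀ → ∀ u : EuclideanSpace ℝ (Fin d) → ℝ,
    Measurable u → ∫⁻ x in Ω ∩ S, ENNReal.ofReal (u x ^ 2) ≤
      C * (rangeEnergy Ω ε u + ∫⁻ x in B, ENNReal.ofReal (u x ^ 2))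

lemma ControlledOn.mono {B S T : Set (EuclideanSpace ℝ (Fin d))} (h : ControlledOn Ω B T)
    (hST : S ⊆ T) : ControlledOn Ω B S := by
  obtain ⟨C, hC, ε₀, hε₀, H⟩ := h
  refine ⟨C, hC, ε₀, hε₀, fun ε h1 h2 u hu => (lintegral_mono_set ?_).trans (H ε h1 h2 u hu)⟩
  exact inter_subset_inter_right _ hST

lemma ControlledOn.union {B S T : Set (EuclideanSpace ℝ (Fin d))} (hS : ControlledOn Ω B S)
    (hT : ControlledOn Ω B T) : ControlledOn Ω B (S ∪ T) := by
  obtain ⟨C, hC, ε₀, hε₀, H⟩ := hS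
  obtain ⟨C', hC', ε₀', hε₀', H'⟩ := hT
  refine ⟨C + C', by finiteness, min ε₀ ε₀', lt_min hε₀ hε₀', fun ε h1 h2 u hu => ?_⟩
  rw [inter_union_distrib_left, add_mul]
  exact (lintegral_union_le _ _ _).trans (add_le_add (H ε h1 (h2.trans_le (min_le_left _ _)) u hu)
    (H' ε h1 (h2.trans_le (min_le_right _ _)) u hu))

lemma controlledOn_empty (B : Set (EuclideanSpace ℝ (Fin d))) : ControlledOn Ω B ∅ :=
  ⟨0, by simp, 1, one_pos, by simp⟩

lemma controlledOn_self (B : Set (EuclideanSpace ℝ (Fin d))) : ControlledOn Ω B B :=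
  ⟨1, by simp, 1, one_pos, fun ε _ _ u _ => by
    rw [one_mul]
    exact (lintegral_mono_set inter_subset_right).trans le_add_self⟩

/-- From u(x)² ≤ 2|u(x) - u(x+v)|² + 2u(x+v)²: the first term is a translation estimate, the second
is an integral over the translated set, which lies in Ω ∩ S. The ball condition along the segments
is an interior cone condition, so segments may start arbitrarily close to ∂Ω. -/
lemma ControlledOn.of_translate (hΩ : IsOpen Ω) {B S A : Set (EuclideanSpace ℝ (Fin d))}
    (hS : ControlledOn Ω B S) {c τ : ℝ} (hτ : 0 < τ) (hc : 0 < c) (hc1 : c ≤ 1)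
    {v q : EuclideanSpace ℝ (Fin d)} (hq : ‖q‖ ≤ 1)
    (hA : ∀ x ∈ Ω ∩ A, ∀ t ∈ Icc (0 : ℝ) 1, x + t • v ∈ Ω ∧
      ∀ s ∈ Ioo 0 τ, Metric.ball (x + t • v + s • q) (c * s) ⊆ Ω)
    (hAS : ∀ x ∈ Ω ∩ A, x + v ∈ S) : ControlledOn Ω B A := by
  obtain ⟨C, hC, ε₀, hε₀, H⟩ := hS
  set C' := stepConst d c * ENNReal.ofReal ((2 * ‖v‖ + 4 * τ) ^ 2)
  have hC' : C' ≠ ∞ := ENNReal.mul_ne_top (stepConst_ne_top hc) ENNReal.ofReal_ne_top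
  refine ⟨2 * C' + 2 * C, by finiteness, min ε₀ (4 * τ), by positivity,
    fun ε h1 h2 u hu => ?_⟩
  set G := rangeEnergy Ω ε u
  set I := ∫⁻ x in B, ENNReal.ofReal (u x ^ 2)
  have hmu : Measurable fun x => ENNReal.ofReal (u x ^ 2) := (hu.pow_const 2).ennreal_ofReal
  have hmp := measurePreserving_add_right (volume : Measure (EuclideanSpace ℝ (Fin d))) v
  calc ∫⁻ x in Ω ∩ A, ENNReal.ofReal (u x ^ 2)
      ≤ ∫⁻ x in Ω ∩ A, (2 * sqDiff u x (x + v) + 2 * ENNReal.ofReal (u (x + v) ^ 2)) :=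
        lintegral_mono fun x => ofReal_sq_le_sqDiff u x (x + v)
    _ = 2 * (∫⁻ x in Ω ∩ A, sqDiff u x (x + v)) +
          2 * ∫⁻ x in Ω ∩ A, ENNReal.ofReal (u (x + v) ^ 2) := by
        have h1 : Measurable fun x => sqDiff u x (x + v) :=
          measurable_sqDiff hu measurable_id (by fun_prop)
        have h2 : Measurable fun x => ENNReal.ofReal (u (x + v) ^ 2) := hmu.comp hmp.measurable
        rw [lintegral_add_left (h1.const_mul 2), lintegral_const_mul _ h1,
          lintegral_const_mul _ h2]
    _ ≤ 2 * (C' * G) + 2 * (C * (G + I)) := by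
        gcongr
        · exact lintegral_sqDiff_translate_le hΩ hc hc1 hq hA h1
            (h2.trans_le (min_le_right _ _)) hu
        · have : ∫⁻ x in Ω ∩ A, ENNReal.ofReal (u (x + v) ^ 2) =
              ∫⁻ y in (fun x => x + v) '' (Ω ∩ A), ENNReal.ofReal (u y ^ 2) :=
            hmp.setLIntegral_comp_emb (Homeomorph.addRight v).measurableEmbedding
              (fun y => ENNReal.ofReal (u y ^ 2)) (Ω ∩ A)
          rw [this]
          refine (lintegral_mono_set ?_).trans (H ε h1 (h2.trans_le (min_le_left _ _)) u hu)
          rintro _ ⟨x, hx, rfl⟩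
          refine ⟨?_, hAS x hx⟩
          simpa using (hA x hx 1 (by simp)).1
    _ ≤ 2 * (C' * (G + I)) + 2 * (C * (G + I)) := by
        gcongr
        exact le_self_add
    _ = (2 * C' + 2 * C) * (G + I) := by ring

/-! ### Lipschitz graph charts and interior cones -/

/-- `Ω` is, inside the ball `B(x₀, r)` and in the vertical direction `e`, the part of space
above the graph of the `L`-Lipschitz function `γ`. -/
structure IsGraphChart (Ω : Set (EuclideanSpace ℝ (Fin d))) (x₀ : EuclideanSpace ℝ (Fin d)) (r : ℝ)
    (e : EuclideanSpace ℝ (Fin d)) (L : ℝ≥0) (γ : (Submodule.span ℝ {e})ᗮ → ℝ) : Prop where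
  pos : 0 < r
  norm_eq : ‖e‖ = 1
  lipschitz : LipschitzWith L γ
  mem_iff : ∀ x ∈ Metric.ball x₀ r,
    (x ∈ Ω ↔ γ ((Submodule.span ℝ {e})ᗮ.orthogonalProjectionOnto x) < inner ℝ e x)

/-- The height of a point above the graph of `γ`. -/
def chartHeight (e : EuclideanSpace ℝ (Fin d)) (γ : (Submodule.span ℝ {e})ᗮ → ℝ)
    (x : EuclideanSpace ℝ (Fin d)) : ℝ :=
  inner ℝ e x - γ ((Submodule.span ℝ {e})ᗮ.orthogonalProjectionOnto x)

namespace IsGraphChart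

variable {x₀ : EuclideanSpace ℝ (Fin d)} {r : ℝ} {e : EuclideanSpace ℝ (Fin d)} {L : ℝ≥0}
  {γ : (Submodule.span ℝ {e})ᗮ → ℝ}

lemma height_add_smul (h : IsGraphChart Ω x₀ r e L γ) (x : EuclideanSpace ℝ (Fin d)) (t : ℝ) :
    chartHeight e γ (x + t • e) = chartHeight e γ x + t := by
  unfold chartHeight
  rw [map_add, map_smul, Submodule.orthogonalProjectionOnto_orthogonalComplement_singleton_eq_zero,
    smul_zero, add_zero, inner_add_right, inner_smul_right, real_inner_self_eq_norm_sq, h.norm_eq]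
  ring

lemma abs_height_sub_le (h : IsGraphChart Ω x₀ r e L γ) (x y : EuclideanSpace ℝ (Fin d)) :
    |chartHeight e γ x - chartHeight e γ y| ≤ (1 + L) * ‖x - y‖ := by
  unfold chartHeight
  have h1 : |inner ℝ e x - inner ℝ e y| ≤ ‖x - y‖ := by
    rw [← inner_sub_right]
    simpa [h.norm_eq] using abs_real_inner_le_norm e (x - y)
  have h2 := h.lipschitz.dist_le_mul ((Submodule.span ℝ {e})ᗮ.orthogonalProjectionOnto x)
    ((Submodule.span ℝ {e})ᗮ.orthogonalProjectionOnto y)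
  rw [Real.dist_eq, dist_eq_norm, ← map_sub] at h2
  have h3 := mul_le_mul_of_nonneg_left
    (Submodule.norm_orthogonalProjectionOnto_apply_le (Submodule.span ℝ {e})ᗮ (x - y)) L.2
  rw [abs_le] at *
  constructor <;> simp only [NNReal.val_eq_coe] at * <;> linarith [h1.1, h1.2, h2.1, h2.2]

lemma continuous_height (h : IsGraphChart Ω x₀ r e L γ) : Continuous (chartHeight e γ) := by
  unfold chartHeight
  have := h.lipschitz.continuous
  fun_prop

lemma mem_iff_height (h : IsGraphChart Ω x₀ r e L γ) {x : EuclideanSpace ℝ (Fin d)}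
    (hx : dist x x₀ < r) : x ∈ Ω ↔ 0 < chartHeight e γ x := by
  rw [h.mem_iff x hx, chartHeight, sub_pos]

lemma height_nonneg_of_mem_closure (h : IsGraphChart Ω x₀ r e L γ) {x : EuclideanSpace ℝ (Fin d)}
    (hx : dist x x₀ < r) (hxΩ : x ∈ closure Ω) : 0 ≤ chartHeight e γ x := by
  have hmem : x ∈ closure (Metric.ball x₀ r ∩ Ω) :=
    Metric.isOpen_ball.inter_closure ⟨hx, hxΩ⟩
  refine closure_minimal (t := {y | 0 ≤ chartHeight e γ y}) ?_
    (isClosed_le continuous_const h.continuous_height) hmem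
  exact fun y hy => ((h.mem_iff_height hy.1).1 hy.2).le

lemma height_eq_zero_of_mem_frontier (h : IsGraphChart Ω x₀ r e L γ) (hΩ : IsOpen Ω)
    {x : EuclideanSpace ℝ (Fin d)} (hx : dist x x₀ < r) (hxΩ : x ∈ frontier Ω) :
    chartHeight e γ x = 0 := by
  refine le_antisymm ?_ (h.height_nonneg_of_mem_closure hx hxΩ.1)
  rw [hΩ.frontier_eq] at hxΩ
  exact not_lt.1 fun hlt => hxΩ.2 ((h.mem_iff_height hx).2 hlt)

lemma cone_pos (L : ℝ≥0) : 0 < (1 + (L : ℝ))⁻¹ := by positivity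

lemma cone_le_one (L : ℝ≥0) : (1 + (L : ℝ))⁻¹ ≤ 1 := inv_le_one_of_one_le₀ (by simp)

/-- Moving up by t raises the height by t, and the height is (1+L)-Lipschitz, so it stays positive
on a ball of radius t/(1+L). The margin 2t keeps this ball inside the chart: t for the shift and at
most t for the radius. -/
lemma ball_subset (h : IsGraphChart Ω x₀ r e L γ) {x : EuclideanSpace ℝ (Fin d)} {t : ℝ}
    (hx : 0 ≤ chartHeight e γ x) (ht : 0 < t) (hxt : dist x x₀ + 2 * t ≤ r) :
    Metric.ball (x + t • e) ((1 + (L : ℝ))⁻¹ * t) ⊆ Ω := by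
  intro y hy
  have hy1 : ‖y - (x + t • e)‖ < (1 + (L : ℝ))⁻¹ * t := by rwa [← dist_eq_norm]
  have hy2 : (1 + (L : ℝ))⁻¹ * t ≤ t := by nlinarith [cone_le_one L]
  have hd : dist y x₀ < r := by
    have h1 : dist (x + t • e) x ≤ t := by
      rw [dist_eq_norm, add_sub_cancel_left, norm_smul, h.norm_eq, mul_one,
        Real.norm_of_nonneg ht.le]
    have h2 := dist_triangle4 y (x + t • e) x x₀
    rw [← dist_eq_norm] at hy1
    linarith
  rw [h.mem_iff_height hd]
  have h3 := h.abs_height_sub_le y (x + t • e)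
  rw [h.height_add_smul, abs_le] at h3
  have h4 : (1 + (L : ℝ)) * ‖y - (x + t • e)‖ < t := by
    rwa [← lt_inv_mul_iff₀ (by positivity)]
  linarith [h3.1]

lemma add_smul_mem (h : IsGraphChart Ω x₀ r e L γ) {x : EuclideanSpace ℝ (Fin d)} {t : ℝ}
    (hx : 0 ≤ chartHeight e γ x) (ht : 0 < t) (hxt : dist x x₀ + 2 * t ≤ r) :
    x + t • e ∈ Ω :=
  h.ball_subset hx ht hxt (Metric.mem_ball_self (mul_pos (cone_pos L) ht))

end IsGraphChart

lemma IsBoundedLipschitzDomain.exists_chart (hΩ : IsBoundedLipschitzDomain Ω)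
    {x₀ : EuclideanSpace ℝ (Fin d)} (hx₀ : x₀ ∈ frontier Ω) :
    ∃ (r : ℝ) (e : EuclideanSpace ℝ (Fin d)) (L : ℝ≥0) (γ : (Submodule.span ℝ {e})ᗮ → ℝ),
      IsGraphChart Ω x₀ r e L γ := by
  obtain ⟨r, hr, e, he, L, γ, hγ, H⟩ := hΩ.lipschitz_boundary x₀ hx₀
  exact ⟨r, e, L, γ, hr, he, hγ, H⟩

/-! ### Propagation of control to the whole domain -/

/-- Control near one point of `Ω` propagates to every point of `Ω`. -/
lemma exists_controlledOn_ball (hΩ : IsOpen Ω) (hc : IsPreconnected Ω)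
    {B : Set (EuclideanSpace ℝ (Fin d))} {p : EuclideanSpace ℝ (Fin d)} (hp : p ∈ Ω) {s : ℝ}
    (hs : 0 < s) (hps : ControlledOn Ω B (Metric.ball p s)) :
    ∀ x ∈ Ω, ∃ r > 0, ControlledOn Ω B (Metric.ball x r) := by
  set U : Set (EuclideanSpace ℝ (Fin d)) := {x | ∃ r > 0, ControlledOn Ω B (Metric.ball x r)}
  have hU : IsOpen U := by
    rw [Metric.isOpen_iff]
    rintro x ⟨r, hr, h⟩
    refine ⟨r / 2, by positivity, fun y hy => ⟨r / 2, by positivity, h.mono ?_⟩⟩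
    apply Metric.ball_subset_ball'
    rw [Metric.mem_ball] at hy
    linarith
  -- Connectedness: the open set U meets Ω, so it suffices that U contains its limit points in Ω.
  -- Near such a point x, a translation to a nearby y in U stays well inside a ball contained in Ω,
  -- so no cone is needed and q = 0, c = 1 work.
  refine hc.subset_of_closure_inter_subset hU ⟨p, hp, s, hs, hps⟩ ?_
  rintro x ⟨hxU, hxΩ⟩
  obtain ⟨ρ, hρ, hρΩ⟩ := Metric.isOpen_iff.1 hΩ x hxΩ
  obtain ⟨y, ⟨r, hr, hy⟩, hxy⟩ := Metric.mem_closure_iff.1 hxU (ρ / 4) (by positivity)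
  rw [dist_comm, dist_eq_norm] at hxy
  refine ⟨min r (ρ / 4), by positivity, ?_⟩
  refine hy.of_translate hΩ (c := 1) (τ := ρ / 4) (v := y - x) (q := 0) (by positivity) one_pos le_rfl
    (by simp) ?_ ?_
  · rintro z ⟨_, hz⟩ t ht
    have hz' : ‖z - x‖ < ρ / 4 := by
      rw [← dist_eq_norm]; exact (Metric.mem_ball.1 hz).trans_le (min_le_right _ _)
    have hdist : dist (z + t • (y - x)) x < ρ / 2 := by
      rw [dist_eq_norm, show z + t • (y - x) - x = (z - x) + t • (y - x) by abel]
      refine (norm_add_le _ _).trans_lt ?_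
      rw [norm_smul, Real.norm_of_nonneg ht.1]
      nlinarith [ht.2, norm_nonneg (y - x)]
    refine ⟨hρΩ (Metric.mem_ball.2 (by linarith)), fun s hs => ?_⟩
    refine (Metric.ball_subset_ball' ?_).trans hρΩ
    rw [smul_zero, add_zero]
    linarith [hs.2]
  · rintro z ⟨_, hz⟩
    rw [Metric.mem_ball, dist_eq_norm] at hz ⊢
    rw [show z + (y - x) - y = z - x by abel]
    exact hz.trans_le (min_le_left _ _)

/-- Nonlocal Poincaré-type inequality on a bounded Lipschitz domain: the control near one interior
point propagates to the whole domain. -/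
theorem IsBoundedLipschitzDomain.controlledOn_univ (hΩ : IsBoundedLipschitzDomain Ω)
    {B : Set (EuclideanSpace ℝ (Fin d))} {p : EuclideanSpace ℝ (Fin d)} (hp : p ∈ Ω) {s : ℝ}
    (hs : 0 < s) (hps : ControlledOn Ω B (Metric.ball p s)) : ControlledOn Ω B univ := by
  have hint := exists_controlledOn_ball hΩ.isOpen hΩ.isConnected.isPreconnected hp hs hps
  have hloc : ∀ x ∈ closure Ω, ∃ t ∈ 𝓝[closure Ω] x, ControlledOn Ω B t := by
    intro x hx
    by_cases hxΩ : x ∈ Ω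
    · obtain ⟨r, hr, h⟩ := hint x hxΩ
      exact ⟨_, mem_nhdsWithin_of_mem_nhds (Metric.ball_mem_nhds x hr), h⟩
    have hxf : x ∈ frontier Ω := by rw [hΩ.isOpen.frontier_eq]; exact ⟨hx, hxΩ⟩
    obtain ⟨r, e, L, γ, hch⟩ := hΩ.exists_chart hxf
    have hr := hch.pos
    have hx0 : 0 ≤ chartHeight e γ x := hch.height_nonneg_of_mem_closure (by simpa using hr) hx
    -- At a boundary point, control is pulled down from the interior point x + v. Vertical segments
    -- of length r/8 and cones of height below r/8, started within r/8 of x, remain in the chart.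
    set v := (r / 8) • e with hv
    have hxv : x + v ∈ Ω := hch.add_smul_mem hx0 (by positivity) (by rw [dist_self]; linarith)
    obtain ⟨ρ, hρ, hcon⟩ := hint _ hxv
    refine ⟨_, mem_nhdsWithin_of_mem_nhds
      (Metric.ball_mem_nhds x (lt_min hρ (by positivity : 0 < r / 8))), ?_⟩
    refine hcon.of_translate hΩ.isOpen (τ := r / 8) (v := v) (q := e) (by positivity)
      (IsGraphChart.cone_pos L) (IsGraphChart.cone_le_one L) hch.norm_eq.le ?_ ?_
    · rintro z ⟨hzΩ, hz⟩ t ht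
      have hz' : dist z x < r / 8 := (Metric.mem_ball.1 hz).trans_le (min_le_right _ _)
      have hz0 := ((hch.mem_iff_height (by linarith)).1 hzΩ).le
      rw [hv, smul_smul]
      have htr : 0 ≤ t * (r / 8) := mul_nonneg ht.1 (by positivity)
      have htr' : t * (r / 8) ≤ r / 8 := by nlinarith [ht.2]
      constructor
      · rcases htr.eq_or_lt with h0 | h0
        · rwa [← h0, zero_smul, add_zero]
        · exact hch.add_smul_mem hz0 h0 (by linarith)
      · intro s hs
        refine hch.ball_subset (by rw [hch.height_add_smul]; linarith) hs.1 ?_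
        have : dist (z + (t * (r / 8)) • e) z ≤ r / 8 := by
          rw [dist_eq_norm, add_sub_cancel_left, norm_smul, hch.norm_eq, mul_one,
            Real.norm_of_nonneg htr]
          exact htr'
        linarith [dist_triangle (z + (t * (r / 8)) • e) z x, hs.2]
    · rintro z ⟨_, hz⟩
      rw [Metric.mem_ball, dist_add_right]
      exact (Metric.mem_ball.1 hz).trans_le (min_le_left _ _)
  -- Compactness makes finitely many local constants suffice.
  have hcl : ControlledOn Ω B (closure Ω) :=
    hΩ.isBounded.isCompact_closure.induction_on (controlledOn_empty B)
      (fun _ _ hST hT => hT.mono hST) (fun _ _ h1 h2 => h1.union h2) hloc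
  obtain ⟨C, hC, ε₀, hε₀, H⟩ := hcl
  refine ⟨C, hC, ε₀, hε₀, fun ε h1 h2 u hu => ?_⟩
  rw [inter_univ]
  simpa [inter_eq_left.2 subset_closure] using H ε h1 h2 u hu

/-! ### Lipschitz graphs: slab coordinates and surface measure -/

lemma LipschitzOnWith.euclideanHausdorffMeasure_image_le {X Y : Type*} [EMetricSpace X]
    [MeasurableSpace X] [BorelSpace X] [EMetricSpace Y] [MeasurableSpace Y] [BorelSpace Y]
    {f : X → Y} {K : ℝ≥0} {s : Set X} (h : LipschitzOnWith K f s) (n : ℕ) :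
    Measure.euclideanHausdorffMeasure n (f '' s) ≤
      (K : ℝ≥0∞) ^ n * Measure.euclideanHausdorffMeasure n s := by
  have := h.hausdorffMeasure_image_le (d := n) (by positivity)
  rw [Measure.euclideanHausdorffMeasure_def, Measure.euclideanHausdorffMeasure_def,
    Measure.smul_apply, Measure.smul_apply, ENNReal.smul_def, ENNReal.smul_def, smul_eq_mul,
    smul_eq_mul, mul_left_comm]
  gcongr
  simpa using this

lemma finrank_orthogonal_span_unit {e : EuclideanSpace ℝ (Fin d)} (he : ‖e‖ = 1) :
    Module.finrank ℝ (Submodule.span ℝ {e})ᗮ = d - 1 := by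
  have h1 := (Submodule.span ℝ {e}).finrank_add_finrank_orthogonal
  rw [finrank_span_singleton (by rintro rfl; simp at he), finrank_euclideanSpace_fin] at h1
  omega

/-- The decomposition of space into a hyperplane and its normal line preserves the volume. -/
lemma measurePreserving_add_smul_unit {e : EuclideanSpace ℝ (Fin d)} (he : ‖e‖ = 1) :
    MeasurePreserving (fun p : (Submodule.span ℝ {e})ᗮ × ℝ =>
      (p.1 : EuclideanSpace ℝ (Fin d)) + p.2 • e) (volume.prod volume) volume := by
  have h1 := ((Submodule.span ℝ {e}).measurePreserving_measurableEquivProd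
    (0 : EuclideanSpace ℝ (Fin d))).symm
  rw [InnerProductSpace.euclideanHausdorffMeasure_eq_volume] at h1
  have h2 := (LinearIsometryEquiv.toSpanUnitSingleton (𝕜 := ℝ) e he).measurePreserving.prod
    (MeasurePreserving.id (volume : Measure (Submodule.span ℝ {e})ᗮ))
  have h3 : MeasurePreserving (Prod.swap : (Submodule.span ℝ {e})ᗮ × ℝ → _)
    (volume.prod volume) (volume.prod volume) := Measure.measurePreserving_swap
  have heq : (fun p : (Submodule.span ℝ {e})ᗮ × ℝ => (p.1 : EuclideanSpace ℝ (Fin d)) + p.2 • e) =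
      ((Submodule.span ℝ {e}).measurableEquivProd (0 : EuclideanSpace ℝ (Fin d))).symm ∘
        Prod.map (LinearIsometryEquiv.toSpanUnitSingleton (𝕜 := ℝ) e he) id ∘ Prod.swap := by
    ext p : 1
    simp [add_comm]
  rw [heq]
  exact h1.comp (h2.comp h3)

/-- The point of the graph of `γ` over a point of the hyperplane. -/
def graphPoint {e : EuclideanSpace ℝ (Fin d)} (γ : (Submodule.span ℝ {e})ᗮ → ℝ)
    (y : (Submodule.span ℝ {e})ᗮ) : EuclideanSpace ℝ (Fin d) := (y : EuclideanSpace ℝ (Fin d)) + γ y • e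

lemma proj_coe_add_smul {e : EuclideanSpace ℝ (Fin d)} (y : (Submodule.span ℝ {e})ᗮ) (t : ℝ) :
    (Submodule.span ℝ {e})ᗮ.orthogonalProjectionOnto ((y : EuclideanSpace ℝ (Fin d)) + t • e) = y := by
  rw [map_add, map_smul, Submodule.orthogonalProjectionOnto_orthogonalComplement_singleton_eq_zero,
    smul_zero, add_zero, Submodule.orthogonalProjectionOnto_mem_subspace_eq_self]

lemma inner_coe_orthogonal {e : EuclideanSpace ℝ (Fin d)} (y : (Submodule.span ℝ {e})ᗮ) :
    inner ℝ e (y : EuclideanSpace ℝ (Fin d)) = 0 :=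
  Submodule.mem_orthogonal_singleton_iff_inner_right.1 y.2

lemma proj_add_inner_smul {e : EuclideanSpace ℝ (Fin d)} (he : ‖e‖ = 1)
    (x : EuclideanSpace ℝ (Fin d)) :
    ((Submodule.span ℝ {e})ᗮ.orthogonalProjectionOnto x : EuclideanSpace ℝ (Fin d)) +
      (inner ℝ e x : ℝ) • e = x := by
  have h := Submodule.starProjection_add_starProjection_orthogonal (K := Submodule.span ℝ {e}) x
  rw [Submodule.starProjection_unit_singleton ℝ he] at h
  rw [add_comm]
  exact h

namespace IsGraphChart

variable {x₀ : EuclideanSpace ℝ (Fin d)} {r : ℝ} {e : EuclideanSpace ℝ (Fin d)} {L : ℝ≥0}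
  {γ : (Submodule.span ℝ {e})ᗮ → ℝ}

lemma height_graphPoint (h : IsGraphChart Ω x₀ r e L γ) (y : (Submodule.span ℝ {e})ᗮ) :
    chartHeight e γ (graphPoint γ y) = 0 := by
  unfold chartHeight graphPoint
  rw [proj_coe_add_smul, inner_add_right, inner_coe_orthogonal, inner_smul_right,
    real_inner_self_eq_norm_sq, h.norm_eq]
  ring

lemma lipschitz_graphPoint (h : IsGraphChart Ω x₀ r e L γ) :
    LipschitzWith (1 + L) (graphPoint γ) := by
  refine LipschitzWith.of_dist_le_mul fun y z => ?_
  have h2 := h.lipschitz.dist_le_mul y z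
  rw [Real.dist_eq] at h2
  calc dist (graphPoint γ y) (graphPoint γ z)
      = ‖((y - z : (Submodule.span ℝ {e})ᗮ) : EuclideanSpace ℝ (Fin d)) + (γ y - γ z) • e‖ := by
        rw [dist_eq_norm]; congr 1; simp only [graphPoint, sub_smul, Submodule.coe_sub]; abel
    _ ≤ dist y z + L * dist y z := by
        refine (norm_add_le _ _).trans ?_
        rw [norm_smul, h.norm_eq, mul_one, ← Submodule.coe_norm, ← dist_eq_norm, Real.norm_eq_abs]
        linarith
    _ = _ := by push_cast; ring

lemma graphPoint_proj (h : IsGraphChart Ω x₀ r e L γ) {x : EuclideanSpace ℝ (Fin d)}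
    (hx : chartHeight e γ x = 0) :
    graphPoint γ ((Submodule.span ℝ {e})ᗮ.orthogonalProjectionOnto x) = x := by
  unfold chartHeight at hx
  rw [graphPoint, ← sub_eq_zero.1 hx, proj_add_inner_smul h.norm_eq]

lemma graphPoint_mem_frontier (h : IsGraphChart Ω x₀ r e L γ) (hΩ : IsOpen Ω)
    {y : (Submodule.span ℝ {e})ᗮ} (hy : dist (graphPoint γ y) x₀ < r) :
    graphPoint γ y ∈ frontier Ω := by
  rw [hΩ.frontier_eq]
  have h0 := h.height_graphPoint y
  refine ⟨?_, fun hmem => ?_⟩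
  · have hcont : Tendsto (fun t : ℝ => graphPoint γ y + t • e) (𝓝[>] 0) (𝓝 (graphPoint γ y)) := by
      have : Continuous fun t : ℝ => graphPoint γ y + t • e := by fun_prop
      simpa using (this.tendsto 0).mono_left nhdsWithin_le_nhds
    refine mem_closure_of_tendsto hcont ?_
    have : Ioo (0 : ℝ) ((r - dist (graphPoint γ y) x₀) / 2) ∈ 𝓝[>] (0 : ℝ) :=
      Ioo_mem_nhdsGT (by linarith)
    filter_upwards [this] with t ht
    exact h.add_smul_mem h0.ge ht.1 (by linarith [ht.2])
  · rw [h.mem_iff_height hy, h0] at hmem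
    exact lt_irrefl _ hmem

/-- The map is an orthogonal decomposition composed with the shear (y, t) ↦ (y, t + γ y), a
translation on each fibre. No differentiability of γ is needed. -/
lemma measurePreserving_graph (h : IsGraphChart Ω x₀ r e L γ) :
    MeasurePreserving (fun p : (Submodule.span ℝ {e})ᗮ × ℝ => graphPoint γ p.1 + p.2 • e)
      (volume.prod volume) volume := by
  have h1 : MeasurePreserving (fun p : (Submodule.span ℝ {e})ᗮ × ℝ => (p.1, p.2 + γ p.1))
      (volume.prod volume) (volume.prod volume) :=
    (MeasurePreserving.id _).skew_product (g := fun y t => t + γ y)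
      (by have := h.lipschitz.continuous; fun_prop)
      (ae_of_all _ fun y => (measurePreserving_add_right volume (γ y)).map_eq)
  convert (measurePreserving_add_smul_unit h.norm_eq).comp h1 using 1
  ext p : 1
  simp only [graphPoint, Function.comp_apply, add_smul]
  abel

/-- The part of space over `D` at height between `a` and `b` above the graph. -/
def slab (e : EuclideanSpace ℝ (Fin d)) (γ : (Submodule.span ℝ {e})ᗮ → ℝ)
    (D : Set (Submodule.span ℝ {e})ᗮ) (a b : ℝ) : Set (EuclideanSpace ℝ (Fin d)) :=
  {x | (Submodule.span ℝ {e})ᗮ.orthogonalProjectionOnto x ∈ D ∧ chartHeight e γ x ∈ Ioo a b}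

lemma measurableSet_slab (h : IsGraphChart Ω x₀ r e L γ) {D : Set (Submodule.span ℝ {e})ᗮ}
    (hD : MeasurableSet D) (a b : ℝ) : MeasurableSet (slab e γ D a b) :=
  (hD.preimage (ContinuousLinearMap.continuous _).measurable).inter
    (measurableSet_Ioo.preimage h.continuous_height.measurable)

lemma graphPoint_add_smul_mem_slab (h : IsGraphChart Ω x₀ r e L γ)
    {D : Set (Submodule.span ℝ {e})ᗮ} {a b t : ℝ} {y : (Submodule.span ℝ {e})ᗮ} :
    graphPoint γ y + t • e ∈ slab e γ D a b ↔ y ∈ D ∧ t ∈ Ioo a b := by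
  unfold slab
  rw [mem_ofPred_eq, h.height_add_smul, h.height_graphPoint, zero_add, graphPoint, add_assoc,
    ← add_smul, proj_coe_add_smul]

lemma lintegral_slab (h : IsGraphChart Ω x₀ r e L γ) {D : Set (Submodule.span ℝ {e})ᗮ}
    (hD : MeasurableSet D) (a b : ℝ) {F : EuclideanSpace ℝ (Fin d) → ℝ≥0∞} (hF : Measurable F) :
    ∫⁻ x in slab e γ D a b, F x =
      ∫⁻ y in D, ∫⁻ t in Ioo a b, F (graphPoint γ y + t • e) := by
  rw [← h.measurePreserving_graph.setLIntegral_comp_preimage (h.measurableSet_slab hD a b) hF]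
  have : (fun p : (Submodule.span ℝ {e})ᗮ × ℝ => graphPoint γ p.1 + p.2 • e) ⁻¹' slab e γ D a b =
      D ×ˢ Ioo a b := by
    ext p
    rw [mem_preimage, h.graphPoint_add_smul_mem_slab, mem_prod]
  rw [this, ← Measure.prod_restrict, lintegral_prod]
  exact (hF.comp h.measurePreserving_graph.measurable).aemeasurable

/-- Only this inequality is needed, so the area formula can be avoided: the projection onto the
hyperplane is 1-Lipschitz and does not increase Hausdorff measure, hence flat measure on D is at
most the pushed-forward surface measure. -/
lemma lintegral_graphPoint_le_surface (h : IsGraphChart Ω x₀ r e L γ)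
    {D : Set (Submodule.span ℝ {e})ᗮ} (hD : MeasurableSet D)
    (hDΩ : ∀ y ∈ D, graphPoint γ y ∈ frontier Ω) {g : EuclideanSpace ℝ (Fin d) → ℝ≥0∞}
    (hg : Measurable g) :
    ∫⁻ y in D, g (graphPoint γ y) ≤ ∫⁻ x, g x ∂(surfaceMeasure Ω) := by
  set π := (Submodule.span ℝ {e})ᗮ.orthogonalProjectionOnto
  have hπ : Measurable π := (ContinuousLinearMap.continuous _).measurable
  have hψ : Measurable (graphPoint γ) := h.lipschitz_graphPoint.continuous.measurable
  set Γ : Set (EuclideanSpace ℝ (Fin d)) := frontier Ω ∩ {x | π x ∈ D ∧ chartHeight e γ x = 0}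
  have hΓ : MeasurableSet Γ := isClosed_frontier.measurableSet.inter
    ((hD.preimage hπ).inter
      ((measurableSet_singleton (0 : ℝ)).preimage h.continuous_height.measurable))
  set μ : Measure (EuclideanSpace ℝ (Fin d)) := Measure.euclideanHausdorffMeasure (d - 1)
  have hle : (volume.restrict D : Measure (Submodule.span ℝ {e})ᗮ) ≤ (μ.restrict Γ).map π := by
    refine Measure.le_iff.2 fun A hA => ?_
    rw [Measure.restrict_apply hA, Measure.map_apply hπ hA, Measure.restrict_apply (hπ hA),
      ← InnerProductSpace.euclideanHausdorffMeasure_eq_volume, finrank_orthogonal_span_unit h.norm_eq]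
    have hsub : A ∩ D ⊆ π '' (π ⁻¹' A ∩ Γ) := by
      rintro y ⟨hyA, hyD⟩
      have hπy : π (graphPoint γ y) = y := proj_coe_add_smul y _
      exact ⟨graphPoint γ y, ⟨by rwa [mem_preimage, hπy], hDΩ y hyD, by rwa [hπy],
        h.height_graphPoint y⟩, hπy⟩
    refine (measure_mono hsub).trans ?_
    have hlip : LipschitzOnWith 1 π (π ⁻¹' A ∩ Γ) :=
      (Submodule.lipschitzWith_orthogonalProjectionOnto _).lipschitzOnWith
    simpa using hlip.euclideanHausdorffMeasure_image_le (d - 1)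
  calc ∫⁻ y in D, g (graphPoint γ y) ≤ ∫⁻ y, g (graphPoint γ y) ∂((μ.restrict Γ).map π) :=
        lintegral_mono' hle le_rfl
    _ = ∫⁻ x in Γ, g (graphPoint γ (π x)) ∂μ := lintegral_map (hg.comp hψ) hπ
    _ = ∫⁻ x in Γ, g x ∂μ := setLIntegral_congr_fun hΓ fun x hx => by
        simp only [π, h.graphPoint_proj hx.2.2]
    _ ≤ ∫⁻ x in frontier Ω, g x ∂μ := lintegral_mono_set inter_subset_left

end IsGraphChart

/-- Near each of its points the compact frontier lies in a Lipschitz image of a ball in a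
(d-1)-dimensional space. -/
lemma IsBoundedLipschitzDomain.isFiniteMeasure_surfaceMeasure (hΩ : IsBoundedLipschitzDomain Ω) :
    IsFiniteMeasure (surfaceMeasure Ω) := by
  refine ⟨?_⟩
  rw [surfaceMeasure, Measure.restrict_apply_univ]
  have hcomp : IsCompact (frontier Ω) :=
    hΩ.isBounded.isCompact_closure.of_isClosed_subset isClosed_frontier frontier_subset_closure
  refine hcomp.measure_lt_top_of_nhdsWithin fun x hx => ?_
  obtain ⟨r, e, L, γ, h⟩ := hΩ.exists_chart hx
  set π := (Submodule.span ℝ {e})ᗮ.orthogonalProjectionOnto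
  refine ⟨Metric.ball x r ∩ frontier Ω, 
    inter_comm (frontier Ω) _ ▸ inter_mem_nhdsWithin _ (Metric.ball_mem_nhds x h.pos), ?_⟩
  have hsub : Metric.ball x r ∩ frontier Ω ⊆ graphPoint γ '' Metric.ball (π x) r := by
    rintro y ⟨hy, hyΩ⟩
    refine ⟨π y, ?_, h.graphPoint_proj (h.height_eq_zero_of_mem_frontier hΩ.isOpen hy hyΩ)⟩
    have := (Submodule.lipschitzWith_orthogonalProjectionOnto (Submodule.span ℝ {e})ᗮ).dist_le_mul y x
    rw [NNReal.coe_one, one_mul] at this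
    exact this.trans_lt hy
  refine (measure_mono hsub).trans_lt ?_
  refine (h.lipschitz_graphPoint.lipschitzOnWith.euclideanHausdorffMeasure_image_le (d - 1)).trans_lt ?_
  rw [← finrank_orthogonal_span_unit h.norm_eq, InnerProductSpace.euclideanHausdorffMeasure_eq_volume]
  have := (measure_ball_lt_top (μ := (volume : Measure (Submodule.span ℝ {e})ᗮ)) (x := π x) (r := r)).ne
  finiteness

/-! ### Weighted Cauchy–Schwarz and a counting bound -/

lemma sq_lintegral_mul_le {α : Type*} [MeasurableSpace α] (μ : Measure α) {f g : α → ℝ≥0∞}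
    (hf : AEMeasurable f μ) (hg : AEMeasurable g μ) :
    (∫⁻ x, f x * g x ∂μ) ^ 2 ≤ (∫⁻ x, f x ^ 2 ∂μ) * ∫⁻ x, g x ^ 2 ∂μ := by
  have h := ENNReal.lintegral_mul_le_Lp_mul_Lq μ Real.HolderConjugate.two_two hf hg
  have h2 := pow_le_pow_left' h 2
  simp only [Pi.mul_apply, ENNReal.rpow_two] at h2
  refine h2.trans_eq ?_
  rw [mul_pow, ← ENNReal.rpow_natCast, ← ENNReal.rpow_natCast, ← ENNReal.rpow_mul,
    ← ENNReal.rpow_mul]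
  norm_num

/-- A weighted Cauchy–Schwarz inequality comparing a number with a weighted mean. -/
lemma sq_weight_mul_sq_le {α : Type*} [MeasurableSpace α] {μ : Measure α} {k u : α → ℝ}
    (hk0 : ∀ x, 0 ≤ k x) (hk : Measurable k) (hki : Integrable k μ) (hu : Measurable u)
    (hku : Integrable (fun x => k x * u x) μ) (a : ℝ) :
    (∫⁻ x, ENNReal.ofReal (k x) ∂μ) ^ 2 * ENNReal.ofReal (a ^ 2) ≤
      2 * ENNReal.ofReal ((∫ x, k x * u x ∂μ) ^ 2) +
      2 * ((∫⁻ x, ENNReal.ofReal (k x) ∂μ) *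
        ∫⁻ x, ENNReal.ofReal (k x) * ENNReal.ofReal ((a - u x) ^ 2) ∂μ) := by
  set m := ∫⁻ x, ENNReal.ofReal (k x) ∂μ
  have hm : m = ENNReal.ofReal (∫ x, k x ∂μ) :=
    (ofReal_integral_eq_lintegral_ofReal hki (ae_of_all _ hk0)).symm
  have hM0 : 0 ≤ ∫ x, k x ∂μ := integral_nonneg hk0
  set M := ∫ x, k x ∂μ
  set w := ∫ x, k x * u x ∂μ
  set v := ∫ x, k x * (a - u x) ∂μ
  have hv : v = M * a - w := by
    simp only [v, mul_sub]
    rw [integral_sub (hki.mul_const a) hku, integral_mul_const]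
  have h1 : ENNReal.ofReal (v ^ 2) ≤
      m * ∫⁻ x, ENNReal.ofReal (k x) * ENNReal.ofReal ((a - u x) ^ 2) ∂μ := by
    have e1 : ENNReal.ofReal (v ^ 2) = ‖v‖ₑ ^ 2 := by
      rw [← sq_abs, ENNReal.ofReal_pow (abs_nonneg _), Real.enorm_eq_ofReal_abs]
    rw [e1]
    refine (pow_le_pow_left' (enorm_integral_le_lintegral_enorm _) 2).trans ?_
    -- The weight is split as √k · √k so that Cauchy–Schwarz yields the total mass times the
    -- weighted square.
    have e2 : ∀ x, ‖k x * (a - u x)‖ₑ =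
        ENNReal.ofReal (√(k x)) * ENNReal.ofReal (√(k x) * |a - u x|) := fun x => by
      rw [← ENNReal.ofReal_mul (Real.sqrt_nonneg _), ← mul_assoc, Real.mul_self_sqrt (hk0 x),
        Real.enorm_eq_ofReal_abs, abs_mul, abs_of_nonneg (hk0 x)]
    simp_rw [e2]
    refine (sq_lintegral_mul_le μ (hk.sqrt.ennreal_ofReal).aemeasurable
      (by fun_prop)).trans_eq ?_
    congr 1
    · refine lintegral_congr fun x => ?_
      rw [← ENNReal.ofReal_pow (Real.sqrt_nonneg _), Real.sq_sqrt (hk0 x)]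
    · refine lintegral_congr fun x => ?_
      rw [← ENNReal.ofReal_pow (by positivity), mul_pow, Real.sq_sqrt (hk0 x), sq_abs,
        ENNReal.ofReal_mul (hk0 x)]
  calc m ^ 2 * ENNReal.ofReal (a ^ 2) = ENNReal.ofReal ((M * a) ^ 2) := by
        rw [hm, ← ENNReal.ofReal_pow hM0, ← ENNReal.ofReal_mul (by positivity), mul_pow]
    _ ≤ ENNReal.ofReal (2 * w ^ 2 + 2 * v ^ 2) := by
        apply ENNReal.ofReal_le_ofReal
        rw [hv]; nlinarith [sq_nonneg (w - (M * a - w))]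
    _ = 2 * ENNReal.ofReal (w ^ 2) + 2 * ENNReal.ofReal (v ^ 2) := by
        rw [ENNReal.ofReal_add (by positivity) (by positivity), ENNReal.ofReal_mul (by norm_num),
          ENNReal.ofReal_mul (by norm_num)]
        simp
    _ ≤ _ := by gcongr

/-- Any two admissible indices differ by less than ℓ/τ. This bounds the overlap of vertical
translates of a strip of thickness ℓ at spacing τ. -/
lemma card_filter_sub_mul_le (N : ℕ) {H τ ℓ : ℝ} (hτ : 0 < τ) :
    ((Finset.range N).filter fun j : ℕ => 0 < H - j * τ ∧ H - j * τ ≤ ℓ).card ≤ ⌊ℓ / τ⌋₊ + 1 := by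
  set s := (Finset.range N).filter fun j : ℕ => 0 < H - j * τ ∧ H - j * τ ≤ ℓ
  rcases s.eq_empty_or_nonempty with h | h
  · simp [h]
  have hmin := Finset.min'_mem s h
  set i := s.min' h
  have hsub : s ⊆ Finset.Icc i (i + ⌊ℓ / τ⌋₊) := by
    intro j hj
    have hij : i ≤ j := Finset.min'_le s j hj
    rw [Finset.mem_Icc]
    refine ⟨hij, ?_⟩
    have : j - i ≤ ⌊ℓ / τ⌋₊ := by
      apply Nat.le_floor
      rw [le_div_iff₀ hτ, Nat.cast_sub hij]
      have h1 := (Finset.mem_filter.1 hj).2.1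
      have h2 := (Finset.mem_filter.1 hmin).2.2
      linarith
    omega
  refine (Finset.card_le_card hsub).trans ?_
  rw [Nat.card_Icc]
  omega

/-! ### Bounds for the scaled kernels -/

section Kernel

variable {K : ℝ → ℝ} {ρ : ℝ}

lemma IsKernel.continuous_scaledKernel (hK : IsKernel K ρ) (δ : ℝ) :
    Continuous fun p : EuclideanSpace ℝ (Fin d) × EuclideanSpace ℝ (Fin d) =>
      scaledKernel K δ p.1 p.2 := by
  unfold scaledKernel
  refine continuous_const.mul (hK.contDiffOn.continuousOn.comp_continuous (by fun_prop) ?_)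
  intro p
  rw [mem_Ici]
  positivity

lemma IsKernel.continuous_scaledKernel_right (hK : IsKernel K ρ) (δ : ℝ)
    (x : EuclideanSpace ℝ (Fin d)) : Continuous fun y => scaledKernel K δ x y := by
  unfold scaledKernel
  refine continuous_const.mul (hK.contDiffOn.continuousOn.comp_continuous (by fun_prop) ?_)
  intro y
  rw [mem_Ici]
  positivity

lemma IsKernel.scaledKernel_nonneg (hK : IsKernel K ρ) {δ : ℝ} (hδ : 0 < δ)
    (x y : EuclideanSpace ℝ (Fin d)) : 0 ≤ scaledKernel K δ x y :=
  mul_nonneg (by positivity) (hK.nonneg _ (by positivity))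

lemma IsKernel.scaledKernel_le (hK : IsKernel K ρ) {δ : ℝ} (hδ : 0 < δ)
    (x y : EuclideanSpace ℝ (Fin d)) : scaledKernel K δ x y ≤ 1 / δ ^ d * K 0 := by
  unfold scaledKernel
  gcongr
  exact hK.antitoneOn self_mem_Ici (mem_Ici.2 (by positivity)) (by positivity)

lemma IsKernel.scaledKernel_eq_zero (hK : IsKernel K ρ) (hρ : 0 < ρ) {δ : ℝ} (hδ : 0 < δ)
    {x y : EuclideanSpace ℝ (Fin d)} (hxy : ρ * δ < ‖x - y‖) : scaledKernel K δ x y = 0 := by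
  unfold scaledKernel
  rw [hK.eq_zero, mul_zero]
  rw [div_lt_div_iff₀ (by norm_num) (by positivity)]
  nlinarith [mul_pos hρ hδ]

/-- A decreasing nonnegative kernel that is not identically zero has K 0 > 0, and by continuity it
stays above K 0 / 2 near 0. -/
lemma IsKernel.exists_le_scaledKernel (hK : IsKernel K ρ) (hK0 : ∃ s, 0 ≤ s ∧ K s ≠ 0) :
    ∃ c > 0, ∃ σ > 0, ∀ d : ℕ, ∀ δ : ℝ, 0 < δ → ∀ x y : EuclideanSpace ℝ (Fin d),
      ‖x - y‖ ≤ σ * δ → 1 / δ ^ d * c ≤ scaledKernel K δ x y := by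
  obtain ⟨s, hs, hKs⟩ := hK0
  have hK0 : 0 < K 0 := lt_of_lt_of_le (lt_of_le_of_ne (hK.nonneg s hs) hKs.symm)
    (hK.antitoneOn self_mem_Ici hs hs)
  have hcont := hK.contDiffOn.continuousOn 0 self_mem_Ici
  have hev : ∀ᶠ t in 𝓝[≥] (0 : ℝ), K 0 / 2 < K t :=
    hcont.eventually (lt_mem_nhds (by linarith))
  obtain ⟨η, hη, hηK⟩ := (mem_nhdsGE_iff_exists_Ico_subset).1 hev
  have hη : 0 < η := hη
  refine ⟨K 0 / 2, by positivity, √η, by positivity, fun d δ hδ x y hxy => ?_⟩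
  unfold scaledKernel
  gcongr
  have hsq : ‖x - y‖ ^ 2 ≤ η * δ ^ 2 := by
    calc ‖x - y‖ ^ 2 ≤ (√η * δ) ^ 2 := by gcongr
      _ = η * δ ^ 2 := by rw [mul_pow, Real.sq_sqrt hη.le]
  have hmem : ‖x - y‖ ^ 2 / (4 * δ ^ 2) ∈ Ico 0 η := by
    refine ⟨by positivity, ?_⟩
    rw [div_lt_iff₀ (by positivity)]
    nlinarith [mul_pos hη (pow_pos hδ 2)]
  exact (hηK hmem).le

end Kernel

lemma volume_closedBall_mul (x : EuclideanSpace ℝ (Fin d)) {ρ δ : ℝ} (hρ : 0 < ρ) (hδ : 0 < δ) :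
    volume (Metric.closedBall x (ρ * δ)) = ENNReal.ofReal (δ ^ d) *
      volume (Metric.closedBall (0 : EuclideanSpace ℝ (Fin d)) ρ) := by
  have h := Measure.addHaar_closedBall_mul (volume : Measure (EuclideanSpace ℝ (Fin d))) x hδ.le
    hρ.le
  rw [finrank_euclideanSpace_fin] at h
  rw [← h, mul_comm]

/-! ### Vertical translations of a thin boundary strip -/

namespace IsGraphChart

variable {x₀ : EuclideanSpace ℝ (Fin d)} {r : ℝ} {e : EuclideanSpace ℝ (Fin d)} {L : ℝ≥0}
  {γ : (Submodule.span ℝ {e})ᗮ → ℝ}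

/-- The points of `Ω` near `x₀` at height at most `ℓ` above the graph. -/
def strip (Ω : Set (EuclideanSpace ℝ (Fin d))) (x₀ : EuclideanSpace ℝ (Fin d)) (r : ℝ)
    (e : EuclideanSpace ℝ (Fin d)) (γ : (Submodule.span ℝ {e})ᗮ → ℝ) (ℓ : ℝ) :
    Set (EuclideanSpace ℝ (Fin d)) :=
  {x | x ∈ Ω ∧ dist x x₀ < r / 8 ∧ chartHeight e γ x ≤ ℓ}

lemma measurableSet_strip (h : IsGraphChart Ω x₀ r e L γ) (hΩ : IsOpen Ω) (ℓ : ℝ) :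
    MeasurableSet (strip Ω x₀ r e γ ℓ) :=
  hΩ.measurableSet.inter (Metric.isOpen_ball.measurableSet.inter
    (measurableSet_Iic.preimage h.continuous_height.measurable))

/-- Vertical translations of a thin strip along the boundary gain a factor `ε`. -/
lemma lintegral_sqDiff_strip_le (h : IsGraphChart Ω x₀ r e L γ) (hΩ : IsOpen Ω)
    {ε t lam : ℝ} (hε : 0 < ε) (hlam : 0 < lam) (hεt : ε ≤ t) (htr : t ≤ r / 8)
    {u : EuclideanSpace ℝ (Fin d) → ℝ} (hu : Measurable u) :
    ∫⁻ x in strip Ω x₀ r e γ (lam * ε), sqDiff u x (x + t • e) ≤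
      (⌊3 * lam⌋₊ + 1 : ℕ) * stepConst d (1 + (L : ℝ))⁻¹ * ENNReal.ofReal r *
        (ENNReal.ofReal ε * rangeEnergy Ω ε u) := by
  have ht : 0 < t := hε.trans_le hεt
  set S := strip Ω x₀ r e γ (lam * ε) with hSdef
  -- This N gives 2t < Nε ≤ 3t, so the step τ = t/N lies between ε/3 and ε/2: short enough for the
  -- one-step estimate, long enough to limit overlaps.
  set N : ℕ := ⌊2 * t / ε⌋₊ + 1 with hN
  have hN0 : (0 : ℝ) < N := by positivity
  have hN1 : 2 * t < N * ε := by
    rw [← div_lt_iff₀ hε, hN]; push_cast; exact Nat.lt_floor_add_one _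
  have hN2 : (N : ℝ) * ε ≤ 3 * t := by
    have : (⌊2 * t / ε⌋₊ : ℝ) * ε ≤ 2 * t := by
      rw [← le_div_iff₀ hε]; exact Nat.floor_le (by positivity)
    rw [hN]; push_cast; linarith
  set τ := t / N with hτdef
  have hτ : 0 < τ := by positivity
  have hτN : N * τ = t := by rw [hτdef]; field_simp
  have hτ1 : τ ≤ ε / 2 := by rw [hτdef, div_le_iff₀ hN0]; linarith
  have hτ2 : ε ≤ 3 * τ := by rw [hτdef, ← mul_div_assoc, le_div_iff₀ hN0]; linarith
  have hjs : ∀ j : ℕ, j • (τ • e) = (j * τ) • e := fun j => by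
    rw [← Nat.cast_smul_eq_nsmul ℝ, smul_smul]
  set M : ℕ := ⌊3 * lam⌋₊ + 1
  set F : EuclideanSpace ℝ (Fin d) → ℝ≥0∞ := fun z => sqDiff u z (z + τ • e) with hF
  have hFm : Measurable F := measurable_sqDiff hu measurable_id (by fun_prop)
  have hS : MeasurableSet S := h.measurableSet_strip hΩ _
  set A : Set (EuclideanSpace ℝ (Fin d)) := Ω ∩ Metric.ball x₀ (r / 4) with hA
  have hAm : MeasurableSet A := hΩ.measurableSet.inter Metric.isOpen_ball.measurableSet
  have hemb : ∀ j : ℕ, MeasurableEmbedding fun x : EuclideanSpace ℝ (Fin d) => x + j • (τ • e) :=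
    fun j => (Homeomorph.addRight (j • (τ • e))).measurableEmbedding
  -- Bounded overlap: z lies in the j-th translate only if its height minus jτ is in (0, lam ε]. As
  -- τ ≥ ε/3, this happens for at most ⌊3 lam⌋ + 1 indices, however many steps are made.
  have hcount : ∀ z, ∑ j ∈ Finset.range N, ((fun x => x + j • (τ • e)) '' S).indicator F z ≤
      A.indicator (fun z => M * F z) z := by
    classical
    intro z
    have himg : ∀ j < N, z ∈ (fun x => x + j • (τ • e)) '' S →
        z ∈ A ∧ (0 < chartHeight e γ z - j * τ ∧ chartHeight e γ z - j * τ ≤ lam * ε) := by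
      rintro j hj ⟨x, ⟨hxΩ, hxd, hxh⟩, rfl⟩
      have hr := h.pos
      have hpos := (h.mem_iff_height (by linarith)).1 hxΩ
      have hjt : j * τ ≤ t := by
        rw [← hτN]; gcongr
      have hj0 : 0 ≤ j * τ := by positivity
      dsimp only
      rw [hjs, h.height_add_smul]
      refine ⟨⟨?_, ?_⟩, by linarith, by linarith⟩
      · rcases hj0.eq_or_lt with h0 | h0
        · rwa [← h0, zero_smul, add_zero]
        · exact h.add_smul_mem hpos.le h0 (by linarith)
      · rw [Metric.mem_ball]
        have : dist (x + (j * τ) • e) x = j * τ := by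
          rw [dist_eq_norm, add_sub_cancel_left, norm_smul, h.norm_eq, mul_one,
            Real.norm_of_nonneg hj0]
        linarith [dist_triangle (x + (j * τ) • e) x x₀]
    by_cases hzA : z ∈ A
    · rw [indicator_of_mem hzA]
      calc ∑ j ∈ Finset.range N, ((fun x => x + j • (τ • e)) '' S).indicator F z
          ≤ ∑ j ∈ Finset.range N, if 0 < chartHeight e γ z - j * τ ∧
              chartHeight e γ z - j * τ ≤ lam * ε then F z else 0 := by
            refine Finset.sum_le_sum fun j hj => ?_
            by_cases hz : z ∈ (fun x => x + j • (τ • e)) '' S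
            · rw [indicator_of_mem hz, if_pos (himg j (Finset.mem_range.1 hj) hz).2]
            · rw [indicator_of_notMem hz]; exact zero_le
        _ = ((Finset.range N).filter fun j : ℕ => 0 < chartHeight e γ z - j * τ ∧
              chartHeight e γ z - j * τ ≤ lam * ε).card * F z := by
            rw [← Finset.sum_filter, Finset.sum_const, nsmul_eq_mul]
        _ ≤ M * F z := by
            gcongr
            refine (card_filter_sub_mul_le N hτ).trans ?_
            refine Nat.add_le_add_right (Nat.floor_le_floor ?_) 1
            rw [div_le_iff₀ hτ]
            nlinarith
    · rw [indicator_of_notMem hzA, Finset.sum_eq_zero]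
      intro j hj
      exact indicator_of_notMem (fun hz => hzA (himg j (Finset.mem_range.1 hj) hz).1) _
  have hstep : ∫⁻ z in A, F z ≤
      stepConst d (1 + (L : ℝ))⁻¹ * ENNReal.ofReal (ε ^ 2) * rangeEnergy Ω ε u := by
    refine lintegral_sqDiff_step_le hΩ hε (cone_pos L) (cone_le_one L) hu (h := τ • e)
      (q := (ε / 4) • e) ?_ ?_ ?_
    · rw [norm_smul, h.norm_eq, mul_one, Real.norm_of_nonneg hτ.le]; exact hτ1
    · rw [norm_smul, h.norm_eq, mul_one, Real.norm_of_nonneg (by positivity)]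
    · rintro x ⟨hxΩ, hx⟩
      have hr := h.pos
      rw [Metric.mem_ball] at hx
      have hpos := ((h.mem_iff_height (by linarith)).1 hxΩ).le
      refine ⟨hxΩ, h.add_smul_mem hpos hτ (by linarith), ?_⟩
      have := h.ball_subset hpos (t := ε / 4) (by positivity) (by linarith)
      rwa [← mul_div_assoc] at this
  have hNt : N • (τ • e) = t • e := by rw [hjs, hτN]
  calc ∫⁻ x in S, sqDiff u x (x + t • e)
      ≤ ∫⁻ x in S, N * ∑ j ∈ Finset.range N, F (x + j • (τ • e)) := by
        refine lintegral_mono fun x => ?_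
        dsimp only
        rw [← hNt]
        exact sqDiff_add_nsmul_le u x _ N
    _ = N * ∑ j ∈ Finset.range N, ∫⁻ x in S, F (x + j • (τ • e)) := by
        rw [lintegral_const_mul, lintegral_finsetSum]
        · exact fun j _ => hFm.comp (by fun_prop)
        · exact Finset.measurable_sum _ fun j _ => hFm.comp (by fun_prop)
    _ = N * ∑ j ∈ Finset.range N, ∫⁻ z, ((fun x => x + j • (τ • e)) '' S).indicator F z := by
        congr 1
        refine Finset.sum_congr rfl fun j _ => ?_
        rw [lintegral_indicator ((hemb j).measurableSet_image.2 hS)]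
        exact (measurePreserving_add_right (volume : Measure (EuclideanSpace ℝ (Fin d)))
          (j • (τ • e))).setLIntegral_comp_emb (hemb j) F S
    _ = N * ∫⁻ z, ∑ j ∈ Finset.range N, ((fun x => x + j • (τ • e)) '' S).indicator F z := by
        rw [lintegral_finsetSum]
        exact fun j _ => hFm.indicator ((hemb j).measurableSet_image.2 hS)
    _ ≤ N * ∫⁻ z, A.indicator (fun z => M * F z) z := by
        gcongr with z
        exact hcount z
    _ = N * (M * ∫⁻ z in A, F z) := by
        rw [lintegral_indicator hAm, lintegral_const_mul _ hFm]
    _ ≤ N * (M * (stepConst d (1 + (L : ℝ))⁻¹ * ENNReal.ofReal (ε ^ 2) * rangeEnergy Ω ε u)) := by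
        gcongr
    -- Overlap M replaces one factor N, so the total is N M ε² = M (Nε) ε: since Nε ≤ 3t stays
    -- bounded, a factor ε is gained.
    _ = M * stepConst d (1 + (L : ℝ))⁻¹ * ENNReal.ofReal (N * ε) *
          (ENNReal.ofReal ε * rangeEnergy Ω ε u) := by
        rw [ENNReal.ofReal_mul (by positivity), ENNReal.ofReal_natCast, sq,
          ENNReal.ofReal_mul hε.le]
        ring
    _ ≤ _ := by
        gcongr
        linarith

end IsGraphChart

/-! ### Kernel averages and kernel mass -/

/-- The kernel average `∫_Ω K_δ(x, y) u(y) dy`. -/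
def kernelMean (Ω : Set (EuclideanSpace ℝ (Fin d))) (K : ℝ → ℝ) (δ : ℝ)
    (u : EuclideanSpace ℝ (Fin d) → ℝ) (x : EuclideanSpace ℝ (Fin d)) : ℝ :=
  ∫ y in Ω, scaledKernel K δ x y * u y

/-- The kernel mass `∫_Ω K_δ(x, y) dy`. -/
def kernelMass (Ω : Set (EuclideanSpace ℝ (Fin d))) (K : ℝ → ℝ) (δ : ℝ)
    (x : EuclideanSpace ℝ (Fin d)) : ℝ≥0∞ :=
  ∫⁻ y in Ω, ENNReal.ofReal (scaledKernel K δ x y)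

section Kernel

variable {K : ℝ → ℝ} {ρ : ℝ}

lemma IsKernel.integrableOn_scaledKernel_mul (hK : IsKernel K ρ) {δ : ℝ} (hδ : 0 < δ)
    {u : EuclideanSpace ℝ (Fin d) → ℝ} (hu : IntegrableOn u Ω) (x : EuclideanSpace ℝ (Fin d)) :
    IntegrableOn (fun y => scaledKernel K δ x y * u y) Ω := by
  have hc : Continuous fun y => scaledKernel K δ x y :=
    hK.continuous_scaledKernel_right δ x
  refine hu.bdd_mul (c := 1 / δ ^ d * K 0) hc.aestronglyMeasurable (ae_of_all _ fun y => ?_)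
  rw [Real.norm_of_nonneg (hK.scaledKernel_nonneg hδ x y)]
  exact hK.scaledKernel_le hδ x y

lemma IsKernel.measurable_kernelMean (hK : IsKernel K ρ) (δ : ℝ)
    {u : EuclideanSpace ℝ (Fin d) → ℝ} (hu : Measurable u) :
    Measurable (kernelMean Ω K δ u) := by
  have h : StronglyMeasurable (Function.uncurry fun x y : EuclideanSpace ℝ (Fin d) =>
      scaledKernel K δ x y * u y) :=
    ((hK.continuous_scaledKernel δ).measurable.mul (hu.comp measurable_snd)).stronglyMeasurable
  exact (h.integral_prod_right (ν := volume.restrict Ω)).measurable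

lemma IsKernel.measurable_kernelMass (hK : IsKernel K ρ) (δ : ℝ) :
    Measurable (kernelMass Ω K δ) := by
  have h : Measurable fun p : EuclideanSpace ℝ (Fin d) × EuclideanSpace ℝ (Fin d) =>
      ENNReal.ofReal (scaledKernel K δ p.1 p.2) :=
    (hK.continuous_scaledKernel δ).measurable.ennreal_ofReal
  exact h.lintegral_prod_right'

lemma IsKernel.sq_kernelMass_mul_sq_le (hK : IsKernel K ρ) {δ : ℝ} (hδ : 0 < δ)
    (hΩ : volume Ω ≠ ∞) {u : EuclideanSpace ℝ (Fin d) → ℝ} (hu : Measurable u)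
    (hui : IntegrableOn u Ω) (x z : EuclideanSpace ℝ (Fin d)) :
    kernelMass Ω K δ x ^ 2 * ENNReal.ofReal (u z ^ 2) ≤
      2 * ENNReal.ofReal (kernelMean Ω K δ u x ^ 2) + 2 * (kernelMass Ω K δ x *
        ∫⁻ y in Ω, ENNReal.ofReal (scaledKernel K δ x y) * sqDiff u z y) := by
  have hc : Continuous fun y => scaledKernel K δ x y :=
    hK.continuous_scaledKernel_right δ x
  have hk : IntegrableOn (fun y => scaledKernel K δ x y) Ω := by
    simpa using hK.integrableOn_scaledKernel_mul hδ (integrableOn_const (C := (1 : ℝ)) hΩ) x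
  exact sq_weight_mul_sq_le (hK.scaledKernel_nonneg hδ x) hc.measurable hk hu
    (hK.integrableOn_scaledKernel_mul hδ hui x) (u z)

lemma IsKernel.ofReal_scaledKernel_le (hK : IsKernel K ρ) {δ : ℝ} (hδ : 0 < δ)
    (x y : EuclideanSpace ℝ (Fin d)) : ENNReal.ofReal (scaledKernel K δ x y) ≤
      ENNReal.ofReal (1 / δ ^ d) * ENNReal.ofReal (K 0) := by
  rw [← ENNReal.ofReal_mul (by positivity)]
  exact ENNReal.ofReal_le_ofReal (hK.scaledKernel_le hδ x y)

lemma IsKernel.lintegral_scaledKernel_mul_le (hK : IsKernel K ρ) (hρ : 0 < ρ) {δ : ℝ} (hδ : 0 < δ)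
    (x : EuclideanSpace ℝ (Fin d)) (F : EuclideanSpace ℝ (Fin d) → ℝ≥0∞) :
    ∫⁻ y in Ω, ENNReal.ofReal (scaledKernel K δ x y) * F y ≤
      ENNReal.ofReal (1 / δ ^ d) * ENNReal.ofReal (K 0) *
        ∫⁻ y in Ω ∩ Metric.closedBall x (ρ * δ), F y := by
  set k := ENNReal.ofReal (1 / δ ^ d) * ENNReal.ofReal (K 0)
  calc ∫⁻ y in Ω, ENNReal.ofReal (scaledKernel K δ x y) * F y
      ≤ ∫⁻ y in Ω, (Metric.closedBall x (ρ * δ)).indicator (fun y => k * F y) y := by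
        refine lintegral_mono fun y => ?_
        by_cases hy : y ∈ Metric.closedBall x (ρ * δ)
        · rw [indicator_of_mem hy]
          dsimp only
          gcongr
          exact hK.ofReal_scaledKernel_le hδ x y
        · rw [indicator_of_notMem hy, hK.scaledKernel_eq_zero hρ hδ]
          · simp
          · rw [Metric.mem_closedBall, not_le, dist_comm, dist_eq_norm] at hy
            exact hy
    _ = k * ∫⁻ y in Ω ∩ Metric.closedBall x (ρ * δ), F y := by
        rw [lintegral_indicator Metric.isClosed_closedBall.measurableSet,
          Measure.restrict_restrict Metric.isClosed_closedBall.measurableSet, inter_comm,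
          lintegral_const_mul']
        exact ENNReal.mul_ne_top ENNReal.ofReal_ne_top ENNReal.ofReal_ne_top

lemma ofReal_one_div_pow_mul {δ : ℝ} (hδ : 0 < δ) (n : ℕ) :
    ENNReal.ofReal (1 / δ ^ n) * ENNReal.ofReal (δ ^ n) = 1 := by
  rw [← ENNReal.ofReal_mul (by positivity), one_div, inv_mul_cancel₀ (by positivity),
    ENNReal.ofReal_one]

lemma IsKernel.kernelMass_le (hK : IsKernel K ρ) (hρ : 0 < ρ) {δ : ℝ} (hδ : 0 < δ)
    (x : EuclideanSpace ℝ (Fin d)) : kernelMass Ω K δ x ≤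
      ENNReal.ofReal (K 0) * volume (Metric.closedBall (0 : EuclideanSpace ℝ (Fin d)) ρ) := by
  have h := hK.lintegral_scaledKernel_mul_le (Ω := Ω) hρ hδ x (fun _ => 1)
  simp only [mul_one, setLIntegral_one] at h
  refine h.trans ?_
  calc _ ≤ ENNReal.ofReal (1 / δ ^ d) * ENNReal.ofReal (K 0) *
        volume (Metric.closedBall x (ρ * δ)) := by gcongr; exact inter_subset_right
    _ = (ENNReal.ofReal (1 / δ ^ d) * ENNReal.ofReal (δ ^ d)) * (ENNReal.ofReal (K 0) *
        volume (Metric.closedBall (0 : EuclideanSpace ℝ (Fin d)) ρ)) := by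
        rw [volume_closedBall_mul x hρ hδ]; ring
    _ = _ := by rw [ofReal_one_div_pow_mul hδ, one_mul]

/-- A ball of radius aδ inside both Ω and the region where K_δ ≥ c/δ^d has volume ~ δ^d, which
cancels the normalization and leaves a bound independent of δ. -/
lemma le_kernelMass {c σ a : ℝ} {δ : ℝ} (hδ : 0 < δ)
    {x z : EuclideanSpace ℝ (Fin d)}
    (hK : ∀ y : EuclideanSpace ℝ (Fin d), ‖x - y‖ ≤ σ * δ → 1 / δ ^ d * c ≤ scaledKernel K δ x y)
    (hz : Metric.ball z (a * δ) ⊆ Ω) (hxz : ‖x - z‖ + a * δ ≤ σ * δ) :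
    ENNReal.ofReal c * volume (Metric.ball (0 : EuclideanSpace ℝ (Fin d)) a) ≤
      kernelMass Ω K δ x := by
  have hvol : volume (Metric.ball z (a * δ)) = ENNReal.ofReal (δ ^ d) *
      volume (Metric.ball (0 : EuclideanSpace ℝ (Fin d)) a) := by
    have h := Measure.addHaar_ball_mul_of_pos (volume : Measure (EuclideanSpace ℝ (Fin d))) z hδ a
    rw [finrank_euclideanSpace_fin] at h
    rw [← h, mul_comm]
  calc ENNReal.ofReal c * volume (Metric.ball (0 : EuclideanSpace ℝ (Fin d)) a)
      = (ENNReal.ofReal (1 / δ ^ d) * ENNReal.ofReal (δ ^ d)) * (ENNReal.ofReal c *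
        volume (Metric.ball (0 : EuclideanSpace ℝ (Fin d)) a)) := by
        rw [ofReal_one_div_pow_mul hδ, one_mul]
    _ = ENNReal.ofReal (1 / δ ^ d * c) * volume (Metric.ball z (a * δ)) := by
        rw [hvol, ENNReal.ofReal_mul (by positivity)]; ring
    _ = ∫⁻ _ in Metric.ball z (a * δ), ENNReal.ofReal (1 / δ ^ d * c) := by simp
    _ ≤ ∫⁻ y in Metric.ball z (a * δ), ENNReal.ofReal (scaledKernel K δ x y) := by
        refine setLIntegral_mono' Metric.isOpen_ball.measurableSet fun y hy => ?_
        refine ENNReal.ofReal_le_ofReal (hK y ?_)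
        rw [Metric.mem_ball, dist_comm, dist_eq_norm] at hy
        have := norm_sub_le_norm_sub_add_norm_sub x z y
        linarith
    _ ≤ kernelMass Ω K δ x := lintegral_mono_set hz

end Kernel

/-! ### The slab above a boundary patch -/

namespace IsGraphChart

variable {x₀ : EuclideanSpace ℝ (Fin d)} {r : ℝ} {e : EuclideanSpace ℝ (Fin d)} {L : ℝ≥0}
  {γ : (Submodule.span ℝ {e})ᗮ → ℝ}

/-- The disc in the hyperplane over which the boundary patch is taken. -/
def baseDisc (x₀ : EuclideanSpace ℝ (Fin d)) (r : ℝ) (e : EuclideanSpace ℝ (Fin d)) (L : ℝ≥0) :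
    Set (Submodule.span ℝ {e})ᗮ :=
  Metric.ball ((Submodule.span ℝ {e})ᗮ.orthogonalProjectionOnto x₀) (r / (16 * (1 + L)))

/-- The point x₀ is itself the graph point over its projection, and the graph map is
(1+L)-Lipschitz; this fixes the radius of the disc. -/
lemma dist_graphPoint_lt (h : IsGraphChart Ω x₀ r e L γ) (hΩ : IsOpen Ω) (hx₀ : x₀ ∈ frontier Ω)
    {y : (Submodule.span ℝ {e})ᗮ} (hy : y ∈ baseDisc x₀ r e L) :
    dist (graphPoint γ y) x₀ < r / 16 := by
  have h0 := h.graphPoint_proj (h.height_eq_zero_of_mem_frontier hΩ (by simpa using h.pos) hx₀)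
  have h1 := h.lipschitz_graphPoint.dist_le_mul y
    ((Submodule.span ℝ {e})ᗮ.orthogonalProjectionOnto x₀)
  rw [h0] at h1
  refine h1.trans_lt ?_
  have h2 : dist y ((Submodule.span ℝ {e})ᗮ.orthogonalProjectionOnto x₀) < r / (16 * (1 + L)) := hy
  rw [lt_div_iff₀ (by positivity)] at h2
  push_cast
  linarith

lemma ball_subset_of_mem_slab (h : IsGraphChart Ω x₀ r e L γ) (hΩ : IsOpen Ω)
    (hx₀ : x₀ ∈ frontier Ω) {z : EuclideanSpace ℝ (Fin d)}
    (hz : z ∈ slab e γ (baseDisc x₀ r e L) (r / 16) (r / 8)) :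
    Metric.ball z ((1 + (L : ℝ))⁻¹ * (r / 16)) ⊆ Ω := by
  obtain ⟨hzD, hzh⟩ := hz
  set y := (Submodule.span ℝ {e})ᗮ.orthogonalProjectionOnto z
  set t := chartHeight e γ z with ht
  have hz : graphPoint γ y + t • e = z := by
    rw [graphPoint, add_assoc, ← add_smul, ht, chartHeight, add_sub_cancel,
      proj_add_inner_smul h.norm_eq]
  have hr := h.pos
  have hd := h.dist_graphPoint_lt hΩ hx₀ hzD
  have hb := h.ball_subset (h.height_graphPoint y).ge (t := t) (by linarith [hzh.1])
    (by linarith [hzh.2])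
  rw [hz] at hb
  refine (Metric.ball_subset_ball ?_).trans hb
  have := cone_pos L
  gcongr
  exact hzh.1.le

/-- Averaged small translations inside the slab. -/
lemma lintegral_slab_sqDiff_le (h : IsGraphChart Ω x₀ r e L γ) (hΩ : IsOpen Ω)
    (hx₀ : x₀ ∈ frontier Ω) {ρ σ δ : ℝ} (hσ : 0 < σ) (hδ : 0 < δ)
    (hδr : (ρ + σ) * δ ≤ (1 + (L : ℝ))⁻¹ * (r / 16))
    {u : EuclideanSpace ℝ (Fin d) → ℝ} (hu : Measurable u) :
    ∫⁻ z in slab e γ (baseDisc x₀ r e L) (r / 16) (r / 8),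
      ∫⁻ ζ in Metric.closedBall (0 : EuclideanSpace ℝ (Fin d)) (ρ * δ), sqDiff u z (z + ζ) ≤
      volume (Metric.closedBall (0 : EuclideanSpace ℝ (Fin d)) (ρ * δ)) *
      ((⌊2 * ρ / σ⌋₊ + 1 : ℕ) * (⌊2 * ρ / σ⌋₊ + 1 : ℕ) *
        (stepConst d 1 * ENNReal.ofReal ((σ * δ) ^ 2) * rangeEnergy Ω (σ * δ) u)) := by
  rw [lintegral_lintegral_swap
    (measurable_sqDiff hu measurable_fst (by fun_prop)).aemeasurable, mul_comm (volume _),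
    ← setLIntegral_const]
  refine setLIntegral_mono' Metric.isClosed_closedBall.measurableSet fun ζ hζ => ?_
  have hζ' : ‖ζ‖ ≤ ρ * δ := by simpa using hζ
  -- A displacement of size ρδ needs a number of steps of size σδ/2 that depends only on ρ/σ, not on
  -- δ.
  set N : ℕ := ⌊2 * ρ / σ⌋₊ + 1 with hN
  have hN0 : (0 : ℝ) < N := by positivity
  have hN1 : 2 * ρ < N * σ := by
    rw [← div_lt_iff₀ hσ, hN]; push_cast; exact Nat.lt_floor_add_one _
  have hNζ : N • ((N : ℝ)⁻¹ • ζ) = ζ := by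
    rw [← Nat.cast_smul_eq_nsmul ℝ, smul_smul, mul_inv_cancel₀ hN0.ne', one_smul]
  have key := lintegral_sqDiff_nsmul_le hΩ (mul_pos hσ hδ) one_pos le_rfl hu
    (A := slab e γ (baseDisc x₀ r e L) (r / 16) (r / 8)) (h := (N : ℝ)⁻¹ • ζ) (q := 0)
    ?_ (by rw [norm_zero]; positivity) N ?_
  · rwa [hNζ] at key
  · rw [norm_smul, norm_inv, Real.norm_natCast, inv_mul_le_iff₀ hN0]
    nlinarith
  · intro x hx j hj
    have hball := h.ball_subset_of_mem_slab hΩ hx₀ hx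
    have hjζ : ‖j • ((N : ℝ)⁻¹ • ζ)‖ ≤ ρ * δ := by
      rw [← Nat.cast_smul_eq_nsmul ℝ, smul_smul, norm_smul, norm_mul, norm_inv, Real.norm_natCast,
        Real.norm_natCast, ← div_eq_mul_inv]
      have : (j : ℝ) / N ≤ 1 := by rw [div_le_one hN0]; exact_mod_cast hj
      calc (j : ℝ) / N * ‖ζ‖ ≤ 1 * ‖ζ‖ := by gcongr
        _ ≤ ρ * δ := by rwa [one_mul]
    have hd : dist (x + j • ((N : ℝ)⁻¹ • ζ)) x ≤ ρ * δ := by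
      rwa [dist_eq_norm, add_sub_cancel_left]
    have hσδ := mul_pos hσ hδ
    refine ⟨hball (Metric.mem_ball.2 (by linarith)), ?_⟩
    refine (Metric.ball_subset_ball' ?_).trans hball
    rw [add_zero]
    linarith

/-- Averaged vertical translations starting near the boundary. -/
lemma lintegral_baseDisc_sqDiff_le (h : IsGraphChart Ω x₀ r e L γ) (hΩ : IsOpen Ω)
    (hx₀ : x₀ ∈ frontier Ω) {ρ σ δ : ℝ} (hρ : 0 < ρ) (hσ : 0 < σ) (hδ : 0 < δ)
    (hδr : (ρ + σ) * δ ≤ r / 16)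
    {u : EuclideanSpace ℝ (Fin d) → ℝ} (hu : Measurable u) :
    ∫⁻ y in baseDisc x₀ r e L, ∫⁻ t in Ioo (r / 16) (r / 8),
      ∫⁻ x in Ω ∩ Metric.closedBall (graphPoint γ y) (ρ * δ), sqDiff u x (x + t • e) ≤
      volume (Metric.closedBall (0 : (Submodule.span ℝ {e})ᗮ) (ρ * δ)) *
        (((⌊3 * ((1 + L) * ρ / σ)⌋₊ + 1 : ℕ) * stepConst d (1 + (L : ℝ))⁻¹ * ENNReal.ofReal r *
        (ENNReal.ofReal (σ * δ) * rangeEnergy Ω (σ * δ) u)) * ENNReal.ofReal (r / 16)) := by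
  have hr := h.pos
  have hσδ := mul_pos hσ hδ
  set V := volume (Metric.closedBall (0 : (Submodule.span ℝ {e})ᗮ) (ρ * δ))
  -- Points of Ω within ρδ of the graph patch have height at most (1+L)ρδ, so one strip contains all
  -- the balls.
  set S := strip Ω x₀ r e γ ((1 + L) * ρ / σ * (σ * δ)) with hS
  set X := (⌊3 * ((1 + L) * ρ / σ)⌋₊ + 1 : ℕ) * stepConst d (1 + (L : ℝ))⁻¹ * ENNReal.ofReal r *
        (ENNReal.ofReal (σ * δ) * rangeEnergy Ω (σ * δ) u)
  have hlam : (1 + L) * ρ / σ * (σ * δ) = (1 + L) * (ρ * δ) := by field_simp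
  set T : Set ((Submodule.span ℝ {e})ᗮ × EuclideanSpace ℝ (Fin d)) :=
    {p | dist p.2 (graphPoint γ p.1) ≤ ρ * δ} with hT
  have hTm : MeasurableSet T := by
    have := h.lipschitz_graphPoint.continuous
    exact (isClosed_le (by fun_prop) continuous_const).measurableSet
  have hψ := h.lipschitz_graphPoint.continuous.measurable
  have hsub : ∀ y ∈ baseDisc x₀ r e L, ∀ t : ℝ,
      ∫⁻ x in Ω ∩ Metric.closedBall (graphPoint γ y) (ρ * δ), sqDiff u x (x + t • e) ≤
      ∫⁻ x in S, T.indicator (fun p => sqDiff u p.2 (p.2 + t • e)) (y, x) := by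
    intro y hy t
    have hd := h.dist_graphPoint_lt hΩ hx₀ hy
    have hset : Ω ∩ Metric.closedBall (graphPoint γ y) (ρ * δ) ⊆
        S ∩ Metric.closedBall (graphPoint γ y) (ρ * δ) := by
      rintro x ⟨hxΩ, hx⟩
      rw [Metric.mem_closedBall] at hx
      refine ⟨⟨hxΩ, ?_, ?_⟩, hx⟩
      · linarith [dist_triangle x (graphPoint γ y) x₀]
      · have h1 := h.abs_height_sub_le x (graphPoint γ y)
        rw [h.height_graphPoint, sub_zero, ← dist_eq_norm] at h1
        rw [hlam]
        refine ((le_abs_self _).trans h1).trans ?_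
        gcongr
    refine (lintegral_mono_set hset).trans_eq ?_
    rw [inter_comm, ← Measure.restrict_restrict Metric.isClosed_closedBall.measurableSet,
      ← lintegral_indicator Metric.isClosed_closedBall.measurableSet]
    rfl
  calc _ ≤ ∫⁻ y in baseDisc x₀ r e L, ∫⁻ t in Ioo (r / 16) (r / 8),
          ∫⁻ x in S, T.indicator (fun p => sqDiff u p.2 (p.2 + t • e)) (y, x) :=
        setLIntegral_mono' Metric.isOpen_ball.measurableSet fun y hy =>
          lintegral_mono fun t => hsub y hy t
    _ = ∫⁻ t in Ioo (r / 16) (r / 8), ∫⁻ y in baseDisc x₀ r e L,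
          ∫⁻ x in S, T.indicator (fun p => sqDiff u p.2 (p.2 + t • e)) (y, x) := by
        refine lintegral_lintegral_swap (Measurable.aemeasurable ?_)
        have hm : Measurable fun q : ((Submodule.span ℝ {e})ᗮ × ℝ) × EuclideanSpace ℝ (Fin d) =>
            ((fun q : ((Submodule.span ℝ {e})ᗮ × ℝ) × EuclideanSpace ℝ (Fin d) =>
              (q.1.1, q.2)) ⁻¹' T).indicator (fun q => sqDiff u q.2 (q.2 + q.1.2 • e)) q :=
          (measurable_sqDiff hu measurable_snd (by fun_prop)).indicator
            (hTm.preimage (by fun_prop))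
        exact hm.lintegral_prod_right'
    _ ≤ ∫⁻ t in Ioo (r / 16) (r / 8), V * X := by
        refine setLIntegral_mono' measurableSet_Ioo fun t ht => ?_
        have hm : Measurable fun p : (Submodule.span ℝ {e})ᗮ × EuclideanSpace ℝ (Fin d) =>
            T.indicator (fun p => sqDiff u p.2 (p.2 + t • e)) p :=
          (measurable_sqDiff hu measurable_snd (by fun_prop)).indicator hTm
        rw [lintegral_lintegral_swap hm.aemeasurable]
        calc _ ≤ ∫⁻ x in S, V * sqDiff u x (x + t • e) := by
              refine lintegral_mono fun x => ?_
              set π := (Submodule.span ℝ {e})ᗮ.orthogonalProjectionOnto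
              -- For fixed x, the feet y whose graph point is within ρδ of x lie in a
              -- (d-1)-dimensional ball of radius ρδ. Its volume is of order δ^{d-1}, not δ^d.
              calc _ ≤ ∫⁻ y, (Metric.closedBall (π x) (ρ * δ)).indicator
                      (fun _ => sqDiff u x (x + t • e)) y := by
                    refine (setLIntegral_le_lintegral _ _).trans (lintegral_mono fun y => ?_)
                    by_cases hy : (y, x) ∈ T
                    · have hyx : y ∈ Metric.closedBall (π x) (ρ * δ) := by
                        have h1 := (Submodule.lipschitzWith_orthogonalProjectionOnto
                          (Submodule.span ℝ {e})ᗮ).dist_le_mul x (graphPoint γ y)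
                        rw [NNReal.coe_one, one_mul, graphPoint, proj_coe_add_smul, dist_comm] at h1
                        exact h1.trans hy
                      rw [indicator_of_mem hy, indicator_of_mem hyx]
                    · rw [indicator_of_notMem hy]
                      exact zero_le
                _ = V * sqDiff u x (x + t • e) := by
                    rw [lintegral_indicator Metric.isClosed_closedBall.measurableSet,
                      setLIntegral_const, Measure.addHaar_closedBall_center, mul_comm]
          _ = V * ∫⁻ x in S, sqDiff u x (x + t • e) := by
              rw [lintegral_const_mul]
              exact measurable_sqDiff hu measurable_id (by fun_prop)
          _ ≤ V * X := by
              gcongr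
              have hρδ := mul_pos hρ hδ
              exact h.lintegral_sqDiff_strip_le hΩ hσδ (by positivity) (by linarith [ht.1])
                ht.2.le hu
    _ = V * (X * ENNReal.ofReal (r / 16)) := by
        rw [setLIntegral_const, Real.volume_Ioo, mul_assoc]
        congr 3
        ring

end IsGraphChart

lemma IsBoundedLipschitzDomain.frontier_nonempty (hΩ : IsBoundedLipschitzDomain Ω) (hd : 1 ≤ d) :
    (frontier Ω).Nonempty := by
  have : Nonempty (Fin d) := ⟨⟨0, hd⟩⟩
  refine nonempty_frontier_iff.2 ⟨hΩ.isConnected.nonempty, fun h => ?_⟩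
  have hb := hΩ.isBounded
  rw [h] at hb
  exact NormedSpace.unbounded_univ ℝ (EuclideanSpace ℝ (Fin d)) hb

namespace IsGraphChart

variable {x₀ : EuclideanSpace ℝ (Fin d)} {r : ℝ} {e : EuclideanSpace ℝ (Fin d)} {L : ℝ≥0}
  {γ : (Submodule.span ℝ {e})ᗮ → ℝ}

lemma exists_ball_subset_slab (h : IsGraphChart Ω x₀ r e L γ) (hΩ : IsOpen Ω)
    (hx₀ : x₀ ∈ frontier Ω) : ∃ p ∈ Ω, ∃ s > 0,
      Metric.ball p s ⊆ slab e γ (baseDisc x₀ r e L) (r / 16) (r / 8) := by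
  have hr := h.pos
  -- The centre sits at height 3r/32, midway between r/16 and r/8, and heights in the ball differ
  -- from it by less than r/32.
  set s := r / (32 * (1 + (L : ℝ))) with hs
  have hs0 : 0 < s := by positivity
  have hsub : Metric.ball (x₀ + (3 * r / 32) • e) s ⊆
      slab e γ (baseDisc x₀ r e L) (r / 16) (r / 8) := by
    intro z hz
    rw [Metric.mem_ball] at hz
    constructor
    · have h1 := (Submodule.lipschitzWith_orthogonalProjectionOnto
        (Submodule.span ℝ {e})ᗮ).dist_le_mul z (x₀ + (3 * r / 32) • e)
      rw [NNReal.coe_one, one_mul, map_add, map_smul,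
        Submodule.orthogonalProjectionOnto_orthogonalComplement_singleton_eq_zero, smul_zero,
        add_zero] at h1
      refine Metric.mem_ball.2 (h1.trans_lt (hz.trans_le ?_))
      rw [hs]
      gcongr
      norm_num
    · have h1 := h.abs_height_sub_le z (x₀ + (3 * r / 32) • e)
      rw [h.height_add_smul, h.height_eq_zero_of_mem_frontier hΩ (by simpa using hr) hx₀, zero_add,
        ← dist_eq_norm] at h1
      have h2 : (1 + (L : ℝ)) * dist z (x₀ + (3 * r / 32) • e) < r / 32 := by
        rw [hs, lt_div_iff₀ (by positivity)] at hz
        linarith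
      have h3 := abs_lt.1 (h1.trans_lt h2)
      constructor <;> linarith [h3.1, h3.2]
  refine ⟨_, ?_, s, hs0, hsub⟩
  have hc := cone_pos L
  exact h.ball_subset_of_mem_slab hΩ hx₀ (hsub (Metric.mem_ball_self hs0))
    (Metric.mem_ball_self (by positivity))

end IsGraphChart

/-! ### Control by the boundary term and uniform coercivity -/

variable {K : ℝ → ℝ} {ρ : ℝ}

/-- Pointwise comparison, along a vertical segment, of the values of `u` with the kernel average
at the foot of the segment. -/
lemma IsKernel.sq_mul_sq_le_segment (hK : IsKernel K ρ) (hρ : 0 < ρ) {δ : ℝ} (hδ : 0 < δ)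
    (hΩ : volume Ω ≠ ∞) {u : EuclideanSpace ℝ (Fin d) → ℝ} (hu : Measurable u)
    (hui : IntegrableOn u Ω) {κ κ' : ℝ≥0∞} {x v : EuclideanSpace ℝ (Fin d)}
    (hκ : κ ≤ kernelMass Ω K δ x) (hκ' : kernelMass Ω K δ x ≤ κ') :
    κ ^ 2 * ENNReal.ofReal (u (x + v) ^ 2) ≤
      2 * ENNReal.ofReal (kernelMean Ω K δ u x ^ 2) +
      (4 * κ' * (ENNReal.ofReal (1 / δ ^ d) * ENNReal.ofReal (K 0)) *
        (∫⁻ ζ in Metric.closedBall (0 : EuclideanSpace ℝ (Fin d)) (ρ * δ),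
          sqDiff u (x + v) (x + v + ζ)) +
      4 * κ' * (ENNReal.ofReal (1 / δ ^ d) * ENNReal.ofReal (K 0)) *
        ∫⁻ y in Ω ∩ Metric.closedBall x (ρ * δ), sqDiff u y (y + v)) := by
  set k := ENNReal.ofReal (1 / δ ^ d) * ENNReal.ofReal (K 0)
  set B := Metric.closedBall x (ρ * δ)
  have hm1 : Measurable fun y => sqDiff u (x + v) (y + v) :=
    measurable_sqDiff hu measurable_const (by fun_prop)
  have hm2 : Measurable fun y => sqDiff u y (y + v) :=
    measurable_sqDiff hu measurable_id (by fun_prop)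
  have htr : ∫⁻ y in B, sqDiff u (x + v) (y + v) =
      ∫⁻ ζ in Metric.closedBall (0 : EuclideanSpace ℝ (Fin d)) (ρ * δ),
        sqDiff u (x + v) (x + v + ζ) := by
    have hpre : (fun ζ => ζ + x) ⁻¹' B = Metric.closedBall 0 (ρ * δ) := by
      ext ζ; simp [B, dist_eq_norm]
    rw [← (measurePreserving_add_right volume x).setLIntegral_comp_preimage
      Metric.isClosed_closedBall.measurableSet hm1, hpre]
    refine lintegral_congr fun ζ => ?_
    congr 1; abel
  calc κ ^ 2 * ENNReal.ofReal (u (x + v) ^ 2)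
      ≤ kernelMass Ω K δ x ^ 2 * ENNReal.ofReal (u (x + v) ^ 2) := by gcongr
    _ ≤ 2 * ENNReal.ofReal (kernelMean Ω K δ u x ^ 2) + 2 * (kernelMass Ω K δ x *
        ∫⁻ y in Ω, ENNReal.ofReal (scaledKernel K δ x y) * sqDiff u (x + v) y) :=
        hK.sq_kernelMass_mul_sq_le hδ hΩ hu hui x (x + v)
    _ ≤ 2 * ENNReal.ofReal (kernelMean Ω K δ u x ^ 2) + 2 * (κ' *
        (k * ∫⁻ y in Ω ∩ B, sqDiff u (x + v) y)) := by
        gcongr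
        exact hK.lintegral_scaledKernel_mul_le hρ hδ x _
    -- The difference u(x+v) - u(y) is split at y + v: a small displacement far from the boundary
    -- plus a vertical translation of y by v.
    _ ≤ 2 * ENNReal.ofReal (kernelMean Ω K δ u x ^ 2) + 2 * (κ' *
        (k * (2 * (∫⁻ y in B, sqDiff u (x + v) (y + v)) +
          2 * ∫⁻ y in Ω ∩ B, sqDiff u y (y + v)))) := by
        gcongr
        calc ∫⁻ y in Ω ∩ B, sqDiff u (x + v) y
            ≤ ∫⁻ y in Ω ∩ B, (2 * sqDiff u (x + v) (y + v) + 2 * sqDiff u y (y + v)) := by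
              refine lintegral_mono fun y => ?_
              rw [sqDiff_comm u y]
              exact sqDiff_triangle _ _ _ _
          _ = 2 * (∫⁻ y in Ω ∩ B, sqDiff u (x + v) (y + v)) +
              2 * ∫⁻ y in Ω ∩ B, sqDiff u y (y + v) := by
              rw [lintegral_add_left (hm1.const_mul 2), lintegral_const_mul _ hm1,
                lintegral_const_mul _ hm2]
          _ ≤ _ := by
              gcongr
              exact inter_subset_right
    _ = _ := by
        rw [htr]
        ring

/-- Control of `u` in an interior ball by the nonlocal energy and the boundary penalty, uniformly
for small `δ`. -/
theorem IsBoundedLipschitzDomain.exists_ball_control (hΩ : IsBoundedLipschitzDomain Ω)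
    (hd : 1 ≤ d) (hK : IsKernel K ρ) (hρ : 0 < ρ) (hK0 : ∃ s, 0 ≤ s ∧ K s ≠ 0) {σ : ℝ}
    (hσ : 0 < σ) :
    ∃ p ∈ Ω, ∃ s > 0, ∃ C : ℝ≥0∞, C ≠ ∞ ∧ ∃ δ₀ > 0, ∀ δ, 0 < δ → δ < δ₀ →
      ∀ u : EuclideanSpace ℝ (Fin d) → ℝ, Measurable u → IntegrableOn u Ω →
        ∫⁻ x in Metric.ball p s, ENNReal.ofReal (u x ^ 2) ≤ C * (rangeEnergy Ω (σ * δ) u +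
          ∫⁻ x, ENNReal.ofReal (kernelMean Ω K δ u x ^ 2) ∂(surfaceMeasure Ω)) := by
  obtain ⟨x₀, hx₀⟩ := hΩ.frontier_nonempty hd
  obtain ⟨r, e, L, γ, h⟩ := hΩ.exists_chart hx₀
  obtain ⟨p, hp, s, hs, hps⟩ := h.exists_ball_subset_slab hΩ.isOpen hx₀
  obtain ⟨c, hc, η, hη, hKlow⟩ := hK.exists_le_scaledKernel hK0
  have hr := h.pos
  have hcone := IsGraphChart.cone_pos L
  have hcone1 := IsGraphChart.cone_le_one L
  set D := IsGraphChart.baseDisc x₀ r e L with hDdef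
  have hD : MeasurableSet D := Metric.isOpen_ball.measurableSet
  set W := IsGraphChart.slab e γ D (r / 16) (r / 8) with hW
  -- The cone at height ηδ/2 above a boundary point contains a ball of radius aδ, still within
  -- distance ηδ of that point; it bounds the kernel mass below by κ.
  set a := (1 + (L : ℝ))⁻¹ * (η / 2) with ha
  have ha0 : 0 < a := by positivity
  set κ := ENNReal.ofReal c * volume (Metric.ball (0 : EuclideanSpace ℝ (Fin d)) a)
  set κ' := ENNReal.ofReal (K 0) * volume (Metric.closedBall (0 : EuclideanSpace ℝ (Fin d)) ρ)
  have hκ0 : κ ≠ 0 := mul_ne_zero (by simpa using hc) (Metric.measure_ball_pos _ _ ha0).ne'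
  have hκt : κ ≠ ∞ := ENNReal.mul_ne_top ENNReal.ofReal_ne_top measure_ball_lt_top.ne
  have hκ't : κ' ≠ ∞ := ENNReal.mul_ne_top ENNReal.ofReal_ne_top measure_closedBall_lt_top.ne
  set VH := volume (Metric.closedBall (0 : (Submodule.span ℝ {e})ᗮ) ρ)
  have hVH : VH ≠ ∞ := measure_closedBall_lt_top.ne
  set m : ℝ≥0∞ := ((⌊2 * ρ / σ⌋₊ + 1 : ℕ) : ℝ≥0∞)
  set n : ℝ≥0∞ := ((⌊3 * ((1 + L) * ρ / σ)⌋₊ + 1 : ℕ) : ℝ≥0∞)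
  have hm : m ≠ ∞ := ENNReal.natCast_ne_top _
  have hn : n ≠ ∞ := ENNReal.natCast_ne_top _
  have hs1 : stepConst d 1 ≠ ∞ := stepConst_ne_top one_pos
  have hs2 : stepConst d (1 + (L : ℝ))⁻¹ ≠ ∞ := stepConst_ne_top hcone
  set C₁ := 4 * κ' * κ' * (m * m * (stepConst d 1 * ENNReal.ofReal (r ^ 2))) with hC₁
  set C₂ := 4 * κ' * ENNReal.ofReal (K 0) * VH * (n * stepConst d (1 + (L : ℝ))⁻¹ *
    ENNReal.ofReal r * ENNReal.ofReal σ * ENNReal.ofReal (r / 16)) with hC₂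
  set C₃ := 2 * ENNReal.ofReal (r / 16) with hC₃
  have hC₁t : C₁ ≠ ∞ := by finiteness
  have hC₂t : C₂ ≠ ∞ := by finiteness
  have hC₃t : C₃ ≠ ∞ := by finiteness
  refine ⟨p, hp, s, hs, (κ ^ 2)⁻¹ * (C₁ + C₂ + C₃), ?_,
    min ((1 + (L : ℝ))⁻¹ * (r / 16) / (ρ + σ)) (r / 2 / η), by positivity, ?_⟩
  · have : κ ^ 2 ≠ 0 := pow_ne_zero _ hκ0
    finiteness
  intro δ hδ hδ₀ u hu hui
  have hδ1 : (ρ + σ) * δ ≤ (1 + (L : ℝ))⁻¹ * (r / 16) := by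
    have := hδ₀.trans_le (min_le_left _ _)
    rw [lt_div_iff₀ (by positivity)] at this
    linarith
  have hδ1' : (ρ + σ) * δ ≤ r / 16 := hδ1.trans (by nlinarith)
  have hδ2 : η * δ ≤ r / 2 := by
    have := hδ₀.trans_le (min_le_right _ _)
    rw [lt_div_iff₀ hη] at this
    linarith
  set G := rangeEnergy Ω (σ * δ) u
  set k := ENNReal.ofReal (1 / δ ^ d) * ENNReal.ofReal (K 0) with hk
  have hkt : k ≠ ∞ := ENNReal.mul_ne_top ENNReal.ofReal_ne_top ENNReal.ofReal_ne_top
  set w : EuclideanSpace ℝ (Fin d) → ℝ≥0∞ := fun x => ENNReal.ofReal (kernelMean Ω K δ u x ^ 2)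
  have hw : Measurable w := ((hK.measurable_kernelMean δ hu).pow_const 2).ennreal_ofReal
  set g : EuclideanSpace ℝ (Fin d) → ℝ≥0∞ := fun z =>
    ∫⁻ ζ in Metric.closedBall (0 : EuclideanSpace ℝ (Fin d)) (ρ * δ), sqDiff u z (z + ζ)
  have hg : Measurable g := by
    have : Measurable fun p : EuclideanSpace ℝ (Fin d) × EuclideanSpace ℝ (Fin d) =>
      sqDiff u p.1 (p.1 + p.2) := measurable_sqDiff hu measurable_fst (by fun_prop)
    exact this.lintegral_prod_right'
  have hψ := h.lipschitz_graphPoint.continuous.measurable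
  have hpt : ∀ y ∈ D, ∀ t : ℝ, κ ^ 2 * ENNReal.ofReal (u (graphPoint γ y + t • e) ^ 2) ≤
      2 * w (graphPoint γ y) + (4 * κ' * k * g (graphPoint γ y + t • e) +
        4 * κ' * k * ∫⁻ x in Ω ∩ Metric.closedBall (graphPoint γ y) (ρ * δ),
          sqDiff u x (x + t • e)) := by
    intro y hy t
    refine hK.sq_mul_sq_le_segment hρ hδ hΩ.isBounded.measure_lt_top.ne hu hui ?_
      (hK.kernelMass_le hρ hδ _)
    have hdy := h.dist_graphPoint_lt hΩ.isOpen hx₀ hy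
    have hball := h.ball_subset (h.height_graphPoint y).ge (t := η / 2 * δ) (by positivity)
      (by linarith)
    rw [← mul_assoc] at hball
    refine le_kernelMass hδ (hKlow d δ hδ _) hball ?_
    rw [sub_add_cancel_left, norm_neg, norm_smul, h.norm_eq, mul_one,
      Real.norm_of_nonneg (by positivity)]
    have : a ≤ η / 2 := by rw [ha]; nlinarith
    nlinarith
  -- In the slab the volume δ^d of the displacement ball balances δ^{-d}, so no further gain is
  -- needed.
  have hJ2 : 4 * κ' * k * ∫⁻ z in W, g z ≤ C₁ * G := by
    calc 4 * κ' * k * ∫⁻ z in W, g z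
        ≤ 4 * κ' * k * (volume (Metric.closedBall (0 : EuclideanSpace ℝ (Fin d)) (ρ * δ)) *
          (m * m * (stepConst d 1 * ENNReal.ofReal ((σ * δ) ^ 2) * G))) := by
          gcongr
          exact h.lintegral_slab_sqDiff_le hΩ.isOpen hx₀ hσ hδ hδ1 hu
      _ = (ENNReal.ofReal (1 / δ ^ d) * ENNReal.ofReal (δ ^ d)) *
          (4 * κ' * κ' * (m * m * (stepConst d 1 * ENNReal.ofReal ((σ * δ) ^ 2) * G))) := by
          rw [volume_closedBall_mul 0 hρ hδ]; ring
      _ ≤ 1 * (4 * κ' * κ' * (m * m * (stepConst d 1 * ENNReal.ofReal (r ^ 2) * G))) := by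
          rw [ofReal_one_div_pow_mul hδ]
          gcongr
          nlinarith [mul_pos hρ hδ]
      _ = C₁ * G := by rw [hC₁]; ring
  have hJ1 : 4 * κ' * k * (∫⁻ y in D, ∫⁻ t in Ioo (r / 16) (r / 8),
      ∫⁻ x in Ω ∩ Metric.closedBall (graphPoint γ y) (ρ * δ), sqDiff u x (x + t • e)) ≤ C₂ * G := by
    have hV : volume (Metric.closedBall (0 : (Submodule.span ℝ {e})ᗮ) (ρ * δ)) =
        ENNReal.ofReal (δ ^ (d - 1)) * VH := by
      have := Measure.addHaar_closedBall_mul (volume : Measure (Submodule.span ℝ {e})ᗮ) 0 hδ.le hρ.le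
      rw [finrank_orthogonal_span_unit h.norm_eq] at this
      rw [← this, mul_comm]
    -- The surface integration yields only δ^{d-1}; the factor δ gained on the strip completes it to
    -- δ^d.
    have hpow : ENNReal.ofReal (δ ^ (d - 1)) * ENNReal.ofReal δ = ENNReal.ofReal (δ ^ d) := by
      rw [← ENNReal.ofReal_mul (by positivity), ← pow_succ, Nat.sub_add_cancel hd]
    calc _ ≤ 4 * κ' * k * (volume (Metric.closedBall (0 : (Submodule.span ℝ {e})ᗮ) (ρ * δ)) *
        ((n * stepConst d (1 + (L : ℝ))⁻¹ * ENNReal.ofReal r *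
        (ENNReal.ofReal (σ * δ) * G)) * ENNReal.ofReal (r / 16))) := by
          gcongr
          exact h.lintegral_baseDisc_sqDiff_le hΩ.isOpen hx₀ hρ hσ hδ hδ1' hu
      _ = (ENNReal.ofReal (1 / δ ^ d) * (ENNReal.ofReal (δ ^ (d - 1)) * ENNReal.ofReal δ)) *
          (C₂ * G) := by
          rw [hV, ENNReal.ofReal_mul hσ.le, hC₂]; ring
      _ = C₂ * G := by rw [hpow, ofReal_one_div_pow_mul hδ, one_mul]
  have hsurf : ∫⁻ y in D, w (graphPoint γ y) ≤ ∫⁻ x, w x ∂(surfaceMeasure Ω) := by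
    refine h.lintegral_graphPoint_le_surface hD (fun y hy => ?_) hw
    exact h.graphPoint_mem_frontier hΩ.isOpen
      ((h.dist_graphPoint_lt hΩ.isOpen hx₀ hy).trans (by linarith))
  set S := ∫⁻ x, w x ∂(surfaceMeasure Ω)
  have hum : Measurable fun x => ENNReal.ofReal (u x ^ 2) := (hu.pow_const 2).ennreal_ofReal
  have hmain : κ ^ 2 * ∫⁻ x in W, ENNReal.ofReal (u x ^ 2) ≤ (C₁ + C₂ + C₃) * (G + S) := by
    calc κ ^ 2 * ∫⁻ x in W, ENNReal.ofReal (u x ^ 2)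
        = ∫⁻ y in D, ∫⁻ t in Ioo (r / 16) (r / 8),
            κ ^ 2 * ENNReal.ofReal (u (graphPoint γ y + t • e) ^ 2) := by
          rw [← lintegral_const_mul _ hum, h.lintegral_slab hD _ _ (hum.const_mul _)]
      _ ≤ ∫⁻ y in D, ∫⁻ t in Ioo (r / 16) (r / 8), (2 * w (graphPoint γ y) +
            (4 * κ' * k * g (graphPoint γ y + t • e) +
            4 * κ' * k * ∫⁻ x in Ω ∩ Metric.closedBall (graphPoint γ y) (ρ * δ),
              sqDiff u x (x + t • e))) :=
          setLIntegral_mono' hD fun y hy => lintegral_mono fun t => hpt y hy t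
      _ = ∫⁻ y in D, (C₃ * w (graphPoint γ y) + (4 * κ' * k *
            (∫⁻ t in Ioo (r / 16) (r / 8), g (graphPoint γ y + t • e)) +
            4 * κ' * k * ∫⁻ t in Ioo (r / 16) (r / 8),
              ∫⁻ x in Ω ∩ Metric.closedBall (graphPoint γ y) (ρ * δ), sqDiff u x (x + t • e))) := by
          refine lintegral_congr fun y => ?_
          have hgy : Measurable fun t : ℝ => g (graphPoint γ y + t • e) := hg.comp (by fun_prop)
          rw [lintegral_add_left measurable_const, lintegral_add_left (hgy.const_mul _),
            lintegral_const_mul _ hgy,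
            lintegral_const_mul' (4 * κ' * k) _ (by finiteness), setLIntegral_const, Real.volume_Ioo, show r / 8 - r / 16 = r / 16 by ring, hC₃]
          ring
      _ = C₃ * (∫⁻ y in D, w (graphPoint γ y)) + (4 * κ' * k * (∫⁻ z in W, g z) +
            4 * κ' * k * ∫⁻ y in D, ∫⁻ t in Ioo (r / 16) (r / 8),
              ∫⁻ x in Ω ∩ Metric.closedBall (graphPoint γ y) (ρ * δ), sqDiff u x (x + t • e)) := by
          have hwy : Measurable fun y => w (graphPoint γ y) := hw.comp hψ
          have hgy : Measurable fun y => ∫⁻ t in Ioo (r / 16) (r / 8),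
              g (graphPoint γ y + t • e) := by
            have : Measurable fun p : (Submodule.span ℝ {e})ᗮ × ℝ => g (graphPoint γ p.1 + p.2 • e) :=
              hg.comp h.measurePreserving_graph.measurable
            exact this.lintegral_prod_right'
          rw [lintegral_add_left (hwy.const_mul _), lintegral_add_left (hgy.const_mul _),
            lintegral_const_mul _ hwy, lintegral_const_mul _ hgy,
            lintegral_const_mul' (4 * κ' * k) _ (by finiteness), ← h.lintegral_slab hD _ _ hg]
      _ ≤ C₃ * S + (C₁ * G + C₂ * G) := by gcongr
      _ ≤ C₃ * S + (C₁ * G + C₂ * G) + (C₁ * S + C₂ * S + C₃ * G) := le_self_add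
      _ = (C₁ + C₂ + C₃) * (G + S) := by ring
  calc ∫⁻ x in Metric.ball p s, ENNReal.ofReal (u x ^ 2)
      ≤ ∫⁻ x in W, ENNReal.ofReal (u x ^ 2) := lintegral_mono_set hps
    _ = (κ ^ 2)⁻¹ * (κ ^ 2 * ∫⁻ x in W, ENNReal.ofReal (u x ^ 2)) := by
        rw [← mul_assoc, ENNReal.inv_mul_cancel (pow_ne_zero _ hκ0) (by finiteness), one_mul]
    _ ≤ (κ ^ 2)⁻¹ * ((C₁ + C₂ + C₃) * (G + S)) := by gcongr
    _ = _ := by rw [mul_assoc]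

/-- Uniform coercivity for small `δ`. -/
theorem IsBoundedLipschitzDomain.exists_uniform_coercivity (hΩ : IsBoundedLipschitzDomain Ω)
    (hd : 1 ≤ d) (hK : IsKernel K ρ) (hρ : 0 < ρ) (hK0 : ∃ s, 0 ≤ s ∧ K s ≠ 0) {σ : ℝ}
    (hσ : 0 < σ) :
    ∃ C : ℝ≥0∞, C ≠ ∞ ∧ ∃ δ₀ > 0, ∀ δ, 0 < δ → δ < δ₀ →
      ∀ u : EuclideanSpace ℝ (Fin d) → ℝ, Measurable u → IntegrableOn u Ω →
        ∫⁻ x in Ω, ENNReal.ofReal (u x ^ 2) ≤ C * (rangeEnergy Ω (σ * δ) u +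
          ∫⁻ x, ENNReal.ofReal (kernelMean Ω K δ u x ^ 2) ∂(surfaceMeasure Ω)) := by
  obtain ⟨p, hp, s, hs, C, hC, δ₀, hδ₀, H⟩ := hΩ.exists_ball_control hd hK hρ hK0 hσ
  obtain ⟨C', hC', ε₀, hε₀, H'⟩ := hΩ.controlledOn_univ hp hs (controlledOn_self (Metric.ball p s))
  refine ⟨C' * (1 + C), by finiteness, min δ₀ (ε₀ / σ), by positivity, fun δ hδ hδ' u hu hui => ?_⟩
  have h1 := H δ hδ (hδ'.trans_le (min_le_left _ _)) u hu hui
  have h2 := H' (σ * δ) (by positivity) (by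
    have := hδ'.trans_le (min_le_right _ _)
    rw [lt_div_iff₀ hσ] at this
    linarith) u hu
  rw [inter_univ] at h2
  set G := rangeEnergy Ω (σ * δ) u
  set S := ∫⁻ x, ENNReal.ofReal (kernelMean Ω K δ u x ^ 2) ∂(surfaceMeasure Ω)
  calc _ ≤ C' * (G + C * (G + S)) := h2.trans (by gcongr)
    _ ≤ C' * (G + C * (G + S)) + C' * S := le_self_add
    _ = _ := by ring

/-! ### Poincaré inequality and coercivity at a fixed range -/

lemma rangeEnergy_le_of_le {ε ε' : ℝ} (hε' : 0 < ε') (h : ε' ≤ ε)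
    (u : EuclideanSpace ℝ (Fin d) → ℝ) :
    rangeEnergy Ω ε' u ≤ ENNReal.ofReal ((ε / ε') ^ (d + 2)) * rangeEnergy Ω ε u := by
  have hε : 0 < ε := hε'.trans_le h
  unfold rangeEnergy
  rw [← mul_assoc, ← ENNReal.ofReal_mul (by positivity)]
  have : (ε / ε') ^ (d + 2) * (ε ^ (d + 2))⁻¹ = (ε' ^ (d + 2))⁻¹ := by
    rw [div_pow]; field_simp
  rw [this]
  gcongr
  rintro p ⟨h1, h2, h3⟩
  exact ⟨h1, h2, h3.trans_le h⟩

lemma rangeEnergy_sub_const (ε c : ℝ) (u : EuclideanSpace ℝ (Fin d) → ℝ) :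
    rangeEnergy Ω ε (fun x => u x - c) = rangeEnergy Ω ε u := by
  unfold rangeEnergy sqDiff
  simp only [sub_sub_sub_cancel_right]

/-- Poincaré inequality on an interior ball. -/
lemma lintegral_ball_sqDiff_le (hΩ : IsOpen Ω) {p : EuclideanSpace ℝ (Fin d)} {s : ℝ}
    (hps : Metric.ball p (2 * s) ⊆ Ω) {ε : ℝ} (hε : 0 < ε) (hεs : ε < 4 * s)
    {u : EuclideanSpace ℝ (Fin d) → ℝ} (hu : Measurable u) :
    ∫⁻ x in Metric.ball p s, ∫⁻ y in Metric.ball p s, sqDiff u x y ≤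
      (stepConst d 1 * ENNReal.ofReal ((8 * s) ^ 2) * rangeEnergy Ω ε u) *
        volume (Metric.ball (0 : EuclideanSpace ℝ (Fin d)) (2 * s)) := by
  set B := Metric.ball p s with hBdef
  have hB : MeasurableSet B := Metric.isOpen_ball.measurableSet
  set V := Metric.ball (0 : EuclideanSpace ℝ (Fin d)) (2 * s)
  have hV : MeasurableSet V := Metric.isOpen_ball.measurableSet
  have hs : 0 < s := by linarith
  set T : Set (EuclideanSpace ℝ (Fin d) × EuclideanSpace ℝ (Fin d)) :=
    {q | q.1 + q.2 ∈ B} with hT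
  have hTm : MeasurableSet T := hB.preimage (by fun_prop)
  have hm : Measurable fun q : EuclideanSpace ℝ (Fin d) × EuclideanSpace ℝ (Fin d) =>
      T.indicator (fun q => sqDiff u q.1 (q.1 + q.2)) q :=
    (measurable_sqDiff hu measurable_fst (by fun_prop)).indicator hTm
  -- With y = x + v, the order of integration is exchanged and each fixed v is handled by a
  -- translation estimate; convexity of the ball keeps the segments inside.
  calc ∫⁻ x in B, ∫⁻ y in B, sqDiff u x y
      ≤ ∫⁻ x in B, ∫⁻ v in V, T.indicator (fun q => sqDiff u q.1 (q.1 + q.2)) (x, v) := by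
        refine setLIntegral_mono' hB fun x hx => ?_
        have hmx : Measurable fun y => sqDiff u x y :=
          measurable_sqDiff hu measurable_const measurable_id
        rw [← (measurePreserving_add_left volume x).setLIntegral_comp_preimage hB hmx]
        have hpre : (fun v => x + v) ⁻¹' B ⊆ V := by
          intro v hv
          have h1 : dist (x + v) p < s := hv
          have h2 : dist x p < s := hx
          rw [mem_ball_zero_iff]
          have h3 := dist_triangle_right (x + v) x p
          rw [dist_eq_norm (x + v) x, add_sub_cancel_left] at h3
          linarith
        have hmp : MeasurableSet ((fun v => x + v) ⁻¹' B) := hB.preimage (by fun_prop)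
        rw [← inter_eq_self_of_subset_left hpre, ← Measure.restrict_restrict hmp,
          ← lintegral_indicator hmp]
        rfl
    _ = ∫⁻ v in V, ∫⁻ x in B, T.indicator (fun q => sqDiff u q.1 (q.1 + q.2)) (x, v) :=
        lintegral_lintegral_swap hm.aemeasurable
    _ ≤ ∫⁻ v in V, stepConst d 1 * ENNReal.ofReal ((8 * s) ^ 2) * rangeEnergy Ω ε u := by
        refine setLIntegral_mono' hV fun v hv => ?_
        have hv' : ‖v‖ < 2 * s := by simpa [V] using hv
        have hpm : MeasurableSet {x | x + v ∈ B} := hB.preimage (measurable_id.add_const v)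
        have hind : ∫⁻ x in B, T.indicator (fun q => sqDiff u q.1 (q.1 + q.2)) (x, v) =
            ∫⁻ x in {x | x + v ∈ B} ∩ B, sqDiff u x (x + v) := by
          rw [← Measure.restrict_restrict hpm, ← lintegral_indicator hpm]
          rfl
        rw [hind]
        have key := lintegral_sqDiff_translate_le hΩ (A := {x | x + v ∈ B} ∩ B) (v := v) (q := 0)
          (c := 1) (τ := s) one_pos le_rfl (by simp) ?_ hε hεs hu
        · refine key.trans ?_
          gcongr
          linarith
        · rintro x ⟨hxv, hx⟩ t ht
          have hmem : x + t • v ∈ B := by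
            have := (convex_ball p s) hx hxv (sub_nonneg.2 ht.2) ht.1 (by ring)
            convert this using 1
            rw [sub_smul, one_smul, smul_add]; abel
          have hd : dist (x + t • v) p < s := hmem
          refine ⟨hps (Metric.mem_ball.2 (by linarith)), fun a ha => ?_⟩
          refine (Metric.ball_subset_ball' ?_).trans hps
          rw [smul_zero, add_zero]
          linarith [ha.2]
    _ = _ := by rw [setLIntegral_const]

/-- Nonlocal Poincaré inequality at a fixed interaction range. -/
theorem IsBoundedLipschitzDomain.exists_poincare (hΩ : IsBoundedLipschitzDomain Ω) {ε : ℝ}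
    (hε : 0 < ε) : ∃ C : ℝ≥0∞, C ≠ ∞ ∧ ∀ u : EuclideanSpace ℝ (Fin d) → ℝ, Measurable u →
      ∫⁻ x in Ω, ∫⁻ y in Ω, sqDiff u x y ≤ C * rangeEnergy Ω ε u := by
  obtain ⟨p, hp⟩ := hΩ.isConnected.nonempty
  obtain ⟨R, hR, hpR⟩ := Metric.isOpen_iff.1 hΩ.isOpen p hp
  set s := R / 2
  have hs : 0 < s := by positivity
  have hps : Metric.ball p (2 * s) ⊆ Ω := by rwa [mul_div_cancel₀ R two_ne_zero]
  set B := Metric.ball p s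
  obtain ⟨C, hC, ε₀, hε₀, H⟩ := hΩ.controlledOn_univ hp hs (controlledOn_self B)
  -- The propagation result holds only at small ranges, so the estimate is proved at ε' and returned
  -- to ε at the cost of a power of ε/ε'.
  set ε' := min ε (min (ε₀ / 2) (2 * s))
  have hε' : 0 < ε' := by positivity
  have hε'1 : ε' ≤ ε := min_le_left _ _
  have hε'2 : ε' < ε₀ := lt_of_le_of_lt ((min_le_right _ _).trans (min_le_left _ _)) (by linarith)
  have hε'3 : ε' < 4 * s :=
    lt_of_le_of_lt ((min_le_right _ _).trans (min_le_right _ _)) (by linarith)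
  have hB0 : volume B ≠ 0 := (Metric.measure_ball_pos _ _ hs).ne'
  have hBt : volume B ≠ ∞ := measure_ball_lt_top.ne
  have hΩt : volume Ω ≠ ∞ := hΩ.isBounded.measure_lt_top.ne
  set Q := stepConst d 1 * ENNReal.ofReal ((8 * s) ^ 2) *
    volume (Metric.ball (0 : EuclideanSpace ℝ (Fin d)) (2 * s)) with hQ
  have hQt : Q ≠ ∞ := ENNReal.mul_ne_top (ENNReal.mul_ne_top (stepConst_ne_top one_pos)
    ENNReal.ofReal_ne_top) measure_ball_lt_top.ne
  set q := ENNReal.ofReal ((ε / ε') ^ (d + 2))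
  refine ⟨(volume B)⁻¹ * (4 * volume Ω * (C * (volume B + Q))) * q, by finiteness,
    fun u hu => ?_⟩
  set G := rangeEnergy Ω ε' u
  have hmeas : Measurable fun q : EuclideanSpace ℝ (Fin d) × EuclideanSpace ℝ (Fin d) =>
    sqDiff u q.1 q.2 := measurable_sqDiff hu measurable_fst measurable_snd
  have h1 : ∫⁻ b in B, ∫⁻ x in Ω, sqDiff u x b ≤ C * (volume B + Q) * G := by
    calc ∫⁻ b in B, ∫⁻ x in Ω, sqDiff u x b
        -- The control estimate is applied to u - u(b), which has the same energy as u, and is then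
        -- averaged over b in B.
        ≤ ∫⁻ b in B, C * (G + ∫⁻ x in B, sqDiff u x b) := by
          refine lintegral_mono fun b => ?_
          have := H ε' hε' hε'2 (fun x => u x - u b) (hu.sub_const _)
          rw [inter_univ, rangeEnergy_sub_const] at this
          exact this
      _ = C * (G * volume B + ∫⁻ b in B, ∫⁻ x in B, sqDiff u x b) := by
          rw [lintegral_const_mul' _ _ hC, lintegral_add_left measurable_const,
            setLIntegral_const]
      _ ≤ C * (G * volume B + Q * G) := by
          gcongr
          have := lintegral_ball_sqDiff_le hΩ.isOpen hps hε' hε'3 hu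
          refine (le_of_eq ?_).trans (this.trans_eq ?_)
          · exact lintegral_congr fun b => lintegral_congr fun x => sqDiff_comm u _ _
          · rw [hQ]; ring
      _ = C * (volume B + Q) * G := by ring
  have h2 : volume B * ∫⁻ x in Ω, ∫⁻ y in Ω, sqDiff u x y ≤
      4 * volume Ω * ∫⁻ b in B, ∫⁻ x in Ω, sqDiff u x b := by
    have hxb : ∀ b, Measurable fun x => sqDiff u x b := fun b =>
      measurable_sqDiff hu measurable_id measurable_const
    have hb : Measurable fun b => ∫⁻ x in Ω, sqDiff u x b := by
      exact (hmeas.comp measurable_swap).lintegral_prod_right'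
    calc volume B * ∫⁻ x in Ω, ∫⁻ y in Ω, sqDiff u x y
        = ∫⁻ b in B, ∫⁻ x in Ω, ∫⁻ y in Ω, sqDiff u x y := by rw [setLIntegral_const, mul_comm]
      _ ≤ ∫⁻ b in B, ∫⁻ x in Ω, ∫⁻ y in Ω, (2 * sqDiff u x b + 2 * sqDiff u y b) := by
          refine lintegral_mono fun b => lintegral_mono fun x => lintegral_mono fun y => ?_
          rw [sqDiff_comm u y b]
          exact sqDiff_triangle _ _ _ _
      _ = ∫⁻ b in B, 4 * volume Ω * ∫⁻ x in Ω, sqDiff u x b := by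
          refine lintegral_congr fun b => ?_
          have : ∀ x, ∫⁻ y in Ω, (2 * sqDiff u x b + 2 * sqDiff u y b) =
              2 * volume Ω * sqDiff u x b + 2 * ∫⁻ y in Ω, sqDiff u y b := fun x => by
            rw [lintegral_add_left measurable_const, setLIntegral_const,
              lintegral_const_mul _ (hxb b)]
            ring
          simp_rw [this]
          rw [lintegral_add_left ((hxb b).const_mul _), lintegral_const_mul _ (hxb b),
            setLIntegral_const]
          ring
      _ = _ := lintegral_const_mul _ hb
  calc ∫⁻ x in Ω, ∫⁻ y in Ω, sqDiff u x y
      = (volume B)⁻¹ * (volume B * ∫⁻ x in Ω, ∫⁻ y in Ω, sqDiff u x y) := by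
        rw [← mul_assoc, ENNReal.inv_mul_cancel hB0 hBt, one_mul]
    _ ≤ (volume B)⁻¹ * (4 * volume Ω * (C * (volume B + Q) * (q * rangeEnergy Ω ε u))) := by
        refine mul_le_mul_right (h2.trans (mul_le_mul_right (h1.trans ?_) _)) _
        gcongr
        exact rangeEnergy_le_of_le hε' hε'1 u
    _ = _ := by ring

lemma IsKernel.kernelMass_pos (hK : IsKernel K ρ) (hK0 : ∃ s, 0 ≤ s ∧ K s ≠ 0) (hΩ : IsOpen Ω)
    {δ : ℝ} (hδ : 0 < δ) {x : EuclideanSpace ℝ (Fin d)} (hx : x ∈ closure Ω) :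
    0 < kernelMass Ω K δ x := by
  obtain ⟨c, hc, η, hη, hKlow⟩ := hK.exists_le_scaledKernel hK0
  obtain ⟨z, hz, hxz⟩ := Metric.mem_closure_iff.1 hx (η * δ / 2) (by positivity)
  obtain ⟨R, hR, hzR⟩ := Metric.isOpen_iff.1 hΩ z hz
  set a := min (R / δ) (η / 2)
  have ha : 0 < a := by positivity
  have haR : a * δ ≤ R := by rw [← le_div_iff₀ hδ]; exact min_le_left _ _
  have haη : a * δ ≤ η / 2 * δ := by gcongr; exact min_le_right _ _
  refine lt_of_lt_of_le ?_ (le_kernelMass (a := a) hδ (hKlow d δ hδ x)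
    ((Metric.ball_subset_ball haR).trans hzR) ?_)
  · exact ENNReal.mul_pos (by simpa using hc) (Metric.measure_ball_pos _ _ ha).ne'
  · rw [← dist_eq_norm]; linarith

/-- Coercivity for a fixed `δ`. -/
theorem IsBoundedLipschitzDomain.exists_coercivity (hΩ : IsBoundedLipschitzDomain Ω)
    (hd : 1 ≤ d) (hK : IsKernel K ρ) (hρ : 0 < ρ) (hK0 : ∃ s, 0 ≤ s ∧ K s ≠ 0) {ε δ : ℝ}
    (hε : 0 < ε) (hδ : 0 < δ) :
    ∃ C : ℝ≥0∞, C ≠ ∞ ∧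
      ∀ u : EuclideanSpace ℝ (Fin d) → ℝ, Measurable u → IntegrableOn u Ω →
        ∫⁻ x in Ω, ENNReal.ofReal (u x ^ 2) ≤ C * (rangeEnergy Ω ε u +
          ∫⁻ x, ENNReal.ofReal (kernelMean Ω K δ u x ^ 2) ∂(surfaceMeasure Ω)) := by
  obtain ⟨P, hP, HP⟩ := hΩ.exists_poincare hε
  have hfin := hΩ.isFiniteMeasure_surfaceMeasure
  have hΩt : volume Ω ≠ ∞ := hΩ.isBounded.measure_lt_top.ne
  set κ := ENNReal.ofReal (K 0) * volume (Metric.closedBall (0 : EuclideanSpace ℝ (Fin d)) ρ)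
  have hκ : κ ≠ ∞ := ENNReal.mul_ne_top ENNReal.ofReal_ne_top measure_closedBall_lt_top.ne
  set k := ENNReal.ofReal (1 / δ ^ d) * ENNReal.ofReal (K 0)
  have hkt : k ≠ ∞ := ENNReal.mul_ne_top ENNReal.ofReal_ne_top ENNReal.ofReal_ne_top
  set Z := ∫⁻ x, kernelMass Ω K δ x ^ 2 ∂(surfaceMeasure Ω) with hZ
  have hmm : Measurable fun x => kernelMass Ω K δ x ^ 2 := (hK.measurable_kernelMass δ).pow_const 2
  -- The kernel mass is positive at every boundary point, and the boundary patch over the disc has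
  -- positive surface measure.
  have hZ0 : Z ≠ 0 := by
    obtain ⟨x₀, hx₀⟩ := hΩ.frontier_nonempty hd
    obtain ⟨r, e, L, γ, h⟩ := hΩ.exists_chart hx₀
    have hr := h.pos
    have hfr : ∀ y ∈ IsGraphChart.baseDisc x₀ r e L, graphPoint γ y ∈ frontier Ω := fun y hy =>
      h.graphPoint_mem_frontier hΩ.isOpen
        ((h.dist_graphPoint_lt hΩ.isOpen hx₀ hy).trans (by linarith))
    have hDm : MeasurableSet (IsGraphChart.baseDisc x₀ r e L) := Metric.isOpen_ball.measurableSet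
    have hle := h.lintegral_graphPoint_le_surface hDm hfr hmm
    refine (lt_of_lt_of_le ?_ hle).ne'
    have hmψ : Measurable fun y => kernelMass Ω K δ (graphPoint γ y) ^ 2 :=
      hmm.comp h.lipschitz_graphPoint.continuous.measurable
    rw [setLIntegral_pos_iff hmψ]
    have hsub : IsGraphChart.baseDisc x₀ r e L ⊆
        (Function.support fun y => kernelMass Ω K δ (graphPoint γ y) ^ 2) ∩
          IsGraphChart.baseDisc x₀ r e L := fun y hy =>
      ⟨pow_ne_zero 2 (hK.kernelMass_pos hK0 hΩ.isOpen hδ (hfr y hy).1).ne', hy⟩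
    refine lt_of_lt_of_le ?_ (measure_mono hsub)
    exact Metric.measure_ball_pos _ _ (by positivity)
  set m := surfaceMeasure Ω univ
  have hm : m ≠ ∞ := measure_ne_top _ _
  have hZt : Z ≠ ∞ := by
    have : Z ≤ ∫⁻ _, κ ^ 2 ∂(surfaceMeasure Ω) :=
      lintegral_mono fun x => pow_le_pow_left' (hK.kernelMass_le hρ hδ x) 2
    refine ne_top_of_le_ne_top ?_ this
    rw [lintegral_const]
    finiteness
  refine ⟨Z⁻¹ * (2 * volume Ω + 2 * κ * k * P * m), by finiteness, fun u hu hui => ?_⟩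
  set G := rangeEnergy Ω ε u
  set w : EuclideanSpace ℝ (Fin d) → ℝ≥0∞ := fun x => ENNReal.ofReal (kernelMean Ω K δ u x ^ 2)
  have hw : Measurable w := ((hK.measurable_kernelMean δ hu).pow_const 2).ennreal_ofReal
  set I := ∫⁻ x in Ω, ENNReal.ofReal (u x ^ 2)
  have hum : Measurable fun x => ENNReal.ofReal (u x ^ 2) := (hu.pow_const 2).ennreal_ofReal
  -- With δ fixed, the kernel is simply bounded by the constant k, and all differences u(z) - u(y)
  -- are handled by the Poincaré inequality; this is then integrated over ∂Ω.
  have hpt : ∀ x, kernelMass Ω K δ x ^ 2 * I ≤ 2 * volume Ω * w x + 2 * κ * k * (P * G) := by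
    intro x
    calc kernelMass Ω K δ x ^ 2 * I
        = ∫⁻ z in Ω, kernelMass Ω K δ x ^ 2 * ENNReal.ofReal (u z ^ 2) :=
          (lintegral_const_mul _ hum).symm
      _ ≤ ∫⁻ z in Ω, (2 * w x + 2 * κ * k * ∫⁻ y in Ω, sqDiff u z y) := by
          refine lintegral_mono fun z => ?_
          refine (hK.sq_kernelMass_mul_sq_le hδ hΩt hu hui x z).trans ?_
          rw [mul_assoc 2 κ, mul_assoc 2 (κ * k), mul_assoc κ k]
          gcongr
          · exact hK.kernelMass_le hρ hδ x
          · rw [← lintegral_const_mul' _ _ hkt]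
            gcongr with y
            exact hK.ofReal_scaledKernel_le hδ x y
      _ = 2 * volume Ω * w x + 2 * κ * k * ∫⁻ z in Ω, ∫⁻ y in Ω, sqDiff u z y := by
          rw [lintegral_add_left measurable_const, setLIntegral_const,
            lintegral_const_mul' _ _ (by finiteness)]
          ring
      _ ≤ _ := by
          gcongr
          exact HP u hu
  have hmain : Z * I ≤ (2 * volume Ω + 2 * κ * k * P * m) * (G + ∫⁻ x, w x ∂(surfaceMeasure Ω)) := by
    calc Z * I = ∫⁻ x, kernelMass Ω K δ x ^ 2 * I ∂(surfaceMeasure Ω) :=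
          (lintegral_mul_const _ hmm).symm
      _ ≤ ∫⁻ x, (2 * volume Ω * w x + 2 * κ * k * (P * G)) ∂(surfaceMeasure Ω) :=
          lintegral_mono hpt
      _ = 2 * volume Ω * (∫⁻ x, w x ∂(surfaceMeasure Ω)) + 2 * κ * k * P * m * G := by
          rw [lintegral_add_left (hw.const_mul _), lintegral_const_mul _ hw, lintegral_const]
          ring
      _ ≤ 2 * volume Ω * (∫⁻ x, w x ∂(surfaceMeasure Ω)) + 2 * κ * k * P * m * G +
          (2 * volume Ω * G + 2 * κ * k * P * m * (∫⁻ x, w x ∂(surfaceMeasure Ω))) := le_self_add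
      _ = _ := by ring
  calc I = Z⁻¹ * (Z * I) := by rw [← mul_assoc, ENNReal.inv_mul_cancel hZ0 hZt, one_mul]
    _ ≤ _ := by
        rw [mul_assoc]
        gcongr

/-! ### From the residual to the energy, and bounds on minimizers -/

variable {R : ℝ → ℝ}

lemma scaledKernel_comm (δ : ℝ) (x y : EuclideanSpace ℝ (Fin d)) :
    scaledKernel R δ x y = scaledKernel R δ y x := by
  unfold scaledKernel
  rw [norm_sub_rev]

lemma interiorResidual_zero (δ : ℝ) (u : EuclideanSpace ℝ (Fin d) → ℝ)
    (x : EuclideanSpace ℝ (Fin d)) :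
    interiorResidual Ω R δ (fun _ => 0) u x =
      1 / δ ^ 2 * ∫ y in Ω, scaledKernel R δ x y * (u x - u y) := by
  simp [interiorResidual]

lemma boundaryPenalty_zero (δ ξ : ℝ) (u : EuclideanSpace ℝ (Fin d) → ℝ) :
    boundaryPenalty Ω K δ ξ (fun _ => 0) u =
      1 / ξ * ∫ x, kernelMean Ω K δ u x ^ 2 ∂(surfaceMeasure Ω) := by
  simp [boundaryPenalty, kernelMean, integral_neg]

lemma IsKernel.integrable_scaledKernel_mul_prod (hR : IsKernel R ρ) {δ : ℝ} (hδ : 0 < δ)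
    (hΩ : volume Ω ≠ ∞) {u : EuclideanSpace ℝ (Fin d) → ℝ}
    (hu2 : MemLp u 2 (volume.restrict Ω)) :
    Integrable (fun p : EuclideanSpace ℝ (Fin d) × EuclideanSpace ℝ (Fin d) =>
      scaledKernel R δ p.1 p.2 * ((u p.1 - u p.2) * u p.1))
      ((volume.restrict Ω).prod (volume.restrict Ω)) := by
  have : IsFiniteMeasure (volume.restrict Ω) := ⟨by simpa using hΩ.lt_top⟩
  have hu1 : Integrable u (volume.restrict Ω) := hu2.integrable (by norm_num)
  have h1 : Integrable (fun p : EuclideanSpace ℝ (Fin d) × EuclideanSpace ℝ (Fin d) =>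
      (u p.1 - u p.2) * u p.1) ((volume.restrict Ω).prod (volume.restrict Ω)) := by
    have h2 := (hu2.integrable_sq.comp_fst (volume.restrict Ω)).sub (hu1.mul_prod hu1)
    refine h2.congr (ae_of_all _ fun p => ?_)
    simp only [Pi.sub_apply]
    ring
  refine h1.bdd_mul (c := 1 / δ ^ d * R 0)
    (hR.continuous_scaledKernel δ).aestronglyMeasurable (ae_of_all _ fun p => ?_)
  rw [Real.norm_of_nonneg (hR.scaledKernel_nonneg hδ _ _)]
  exact hR.scaledKernel_le hδ _ _

/-- The nonlocal operator is symmetric: `2 δ² ∫ I(u) u = ∫∫ R_δ(x, y) (u(x) - u(y))²`. -/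
lemma IsKernel.lintegral_scaledKernel_sqDiff (hR : IsKernel R ρ) {δ : ℝ} (hδ : 0 < δ)
    (hΩ : volume Ω ≠ ∞) {u : EuclideanSpace ℝ (Fin d) → ℝ}
    (hu2 : MemLp u 2 (volume.restrict Ω)) :
    ∫⁻ p, ENNReal.ofReal (scaledKernel R δ p.1 p.2) * sqDiff u p.1 p.2
      ∂((volume.restrict Ω).prod (volume.restrict Ω)) =
    ENNReal.ofReal (2 * δ ^ 2 * ∫ x in Ω, interiorResidual Ω R δ (fun _ => 0) u x * u x) := by
  have : IsFiniteMeasure (volume.restrict Ω) := ⟨by simpa using hΩ.lt_top⟩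
  set μ := (volume.restrict Ω : Measure (EuclideanSpace ℝ (Fin d)))
  set F : EuclideanSpace ℝ (Fin d) × EuclideanSpace ℝ (Fin d) → ℝ := fun p =>
      scaledKernel R δ p.1 p.2 * ((u p.1 - u p.2) * u p.1) with hF
  have hFi : Integrable F (μ.prod μ) := hR.integrable_scaledKernel_mul_prod hδ hΩ hu2
  -- Symmetrization: R_δ (u(x) - u(y))² is the integrand of δ² I(u) u plus the same integrand with x
  -- and y exchanged.
  have hsum : ∀ p, scaledKernel R δ p.1 p.2 * (u p.1 - u p.2) ^ 2 = F p + F p.swap := fun p => by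
    simp only [hF, Prod.fst_swap, Prod.snd_swap, scaledKernel_comm δ p.2 p.1]
    ring
  have hint : ∫ p, scaledKernel R δ p.1 p.2 * (u p.1 - u p.2) ^ 2 ∂(μ.prod μ) =
      2 * δ ^ 2 * ∫ x in Ω, interiorResidual Ω R δ (fun _ => 0) u x * u x := by
    have hFs : Integrable (fun p => F p.swap) (μ.prod μ) := hFi.swap
    have hx : ∀ x, ∫ y, F (x, y) ∂μ =
        δ ^ 2 * (interiorResidual Ω R δ (fun _ => 0) u x * u x) := fun x => by
      rw [interiorResidual_zero, ← mul_assoc, ← mul_assoc, mul_one_div_cancel (by positivity),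
        one_mul, ← integral_mul_const]
      exact integral_congr_ae (ae_of_all _ fun y => by simp only [hF]; ring)
    simp_rw [hsum]
    rw [integral_add hFi hFs, integral_prod_swap, integral_prod _ hFi]
    simp_rw [hx]
    rw [integral_const_mul]
    ring
  rw [← hint, ofReal_integral_eq_lintegral_ofReal]
  · refine lintegral_congr fun p => ?_
    rw [ENNReal.ofReal_mul (hR.scaledKernel_nonneg hδ _ _)]
    rfl
  · exact (hFi.add hFi.swap).congr (ae_of_all _ fun p => (hsum p).symm)
  · exact ae_of_all _ fun p => mul_nonneg (hR.scaledKernel_nonneg hδ _ _) (sq_nonneg _)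

/-- Pairs at distance below σδ lie where R_δ ≥ c/δ^d. The normalization (σδ)^{-(d+2)} matches δ^d
from the kernel and δ² from the residual, so the constant does not depend on δ. -/
lemma IsKernel.rangeEnergy_le (hR : IsKernel R ρ) {δ c σ : ℝ} (hδ : 0 < δ) (hc : 0 < c)
    (hσ : 0 < σ) (hΩo : IsOpen Ω) (hΩ : volume Ω ≠ ∞)
    (hlow : ∀ x y : EuclideanSpace ℝ (Fin d), ‖x - y‖ ≤ σ * δ → 1 / δ ^ d * c ≤ scaledKernel R δ x y)
    {u : EuclideanSpace ℝ (Fin d) → ℝ} (hu2 : MemLp u 2 (volume.restrict Ω)) :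
    rangeEnergy Ω (σ * δ) u ≤ ENNReal.ofReal (2 / (c * σ ^ (d + 2)) *
      ∫ x in Ω, interiorResidual Ω R δ (fun _ => 0) u x * u x) := by
  have h1 := hR.lintegral_scaledKernel_sqDiff hδ hΩ hu2
  set E := ∫ x in Ω, interiorResidual Ω R δ (fun _ => 0) u x * u x
  rw [Measure.prod_restrict] at h1
  have h2 : ENNReal.ofReal (1 / δ ^ d * c) *
      (∫⁻ p in nearPairs Ω (σ * δ), sqDiff u p.1 p.2 ∂(volume.prod volume)) ≤
      ENNReal.ofReal (2 * δ ^ 2 * E) := by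
    rw [← h1, ← lintegral_const_mul' _ _ ENNReal.ofReal_ne_top]
    refine (setLIntegral_mono' (measurableSet_nearPairs hΩo _) fun p hp => ?_).trans
      (lintegral_mono_set fun p hp => ⟨hp.1, hp.2.1⟩)
    gcongr
    refine hlow _ _ ?_
    rw [← dist_eq_norm]
    exact hp.2.2.le
  have h3 : ENNReal.ofReal (((σ * δ) ^ (d + 2))⁻¹) =
      ENNReal.ofReal (1 / (δ ^ 2 * c * σ ^ (d + 2))) * ENNReal.ofReal (1 / δ ^ d * c) := by
    rw [← ENNReal.ofReal_mul (by positivity)]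
    congr 1
    rw [mul_pow]
    field_simp
    ring
  unfold rangeEnergy
  rw [h3, mul_assoc]
  refine (mul_le_mul_right h2 _).trans_eq ?_
  rw [← ENNReal.ofReal_mul (by positivity)]
  congr 1
  field_simp

lemma IsKernel.memLp_interiorResidual (hR : IsKernel R ρ) {δ : ℝ} (hδ : 0 < δ)
    (hΩ : volume Ω ≠ ∞) {u : EuclideanSpace ℝ (Fin d) → ℝ} (hu : Measurable u)
    (hu2 : MemLp u 2 (volume.restrict Ω)) :
    MemLp (interiorResidual Ω R δ (fun _ => 0) u) 2 (volume.restrict Ω) := by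
  have : IsFiniteMeasure (volume.restrict Ω) := ⟨by simpa using hΩ.lt_top⟩
  set μ := (volume.restrict Ω : Measure (EuclideanSpace ℝ (Fin d)))
  have hu1 : Integrable u μ := hu2.integrable (by norm_num)
  set M := 1 / δ ^ d * R 0 with hM
  have hM0 : 0 ≤ M := mul_nonneg (by positivity) (hR.nonneg 0 le_rfl)
  have hmeas : AEStronglyMeasurable (interiorResidual Ω R δ (fun _ => 0) u) μ := by
    have h : StronglyMeasurable (Function.uncurry fun x y : EuclideanSpace ℝ (Fin d) =>
        scaledKernel R δ x y * (u x - u y)) :=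
      ((hR.continuous_scaledKernel δ).measurable.mul
        ((hu.comp measurable_fst).sub (hu.comp measurable_snd))).stronglyMeasurable
    have h2 : interiorResidual Ω R δ (fun _ => 0) u =
        fun x => 1 / δ ^ 2 * ∫ y, scaledKernel R δ x y * (u x - u y) ∂μ := by
      funext x; exact interiorResidual_zero δ u x
    rw [h2]
    exact (h.integral_prod_right (ν := μ)).aestronglyMeasurable.const_mul _
  have hg : MemLp (fun x => 1 / δ ^ 2 * M * (μ.real univ * |u x| + ∫ y, |u y| ∂μ)) 2 μ :=
    ((hu2.abs.const_mul _).add (memLp_const _)).const_mul _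
  refine hg.mono' hmeas (ae_of_all _ fun x => ?_)
  rw [interiorResidual_zero, norm_mul, Real.norm_of_nonneg (by positivity : 0 ≤ 1 / δ ^ 2),
    mul_assoc (1 / δ ^ 2)]
  gcongr
  calc ‖∫ y, scaledKernel R δ x y * (u x - u y) ∂μ‖
      ≤ ∫ y, M * (|u x| + |u y|) ∂μ := by
        refine norm_integral_le_of_norm_le (((integrable_const _).add hu1.abs).const_mul _)
          (ae_of_all _ fun y => ?_)
        rw [norm_mul, Real.norm_of_nonneg (hR.scaledKernel_nonneg hδ _ _)]
        gcongr
        · exact hR.scaledKernel_le hδ _ _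
        · exact abs_sub _ _
    _ = M * (μ.real univ * |u x| + ∫ y, |u y| ∂μ) := by
        rw [integral_const_mul, integral_add (integrable_const _) hu1.abs, integral_const,
          smul_eq_mul]

lemma IsKernel.integrable_sq_kernelMean (hK : IsKernel K ρ) {δ : ℝ} (hδ : 0 < δ)
    [IsFiniteMeasure (surfaceMeasure Ω)] {u : EuclideanSpace ℝ (Fin d) → ℝ} (hu : Measurable u)
    (hui : IntegrableOn u Ω) :
    Integrable (fun x => kernelMean Ω K δ u x ^ 2) (surfaceMeasure Ω) := by
  refine Integrable.of_bound ((hK.measurable_kernelMean δ hu).pow_const 2).aestronglyMeasurable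
    ((1 / δ ^ d * K 0 * ∫ y in Ω, |u y|) ^ 2) (ae_of_all _ fun x => ?_)
  rw [norm_pow]
  gcongr
  rw [← integral_const_mul]
  refine norm_integral_le_of_norm_le (hui.abs.const_mul _) (ae_of_all _ fun y => ?_)
  rw [norm_mul, Real.norm_of_nonneg (hK.scaledKernel_nonneg hδ _ _)]
  exact mul_le_mul_of_nonneg_right (hK.scaledKernel_le hδ _ _) (abs_nonneg _)

/-- Supplies the competitor 0. The representative of 0 in L² vanishes only almost everywhere,
whereas the integrands are evaluated pointwise. -/
lemma nonlocalEnergy_of_ae_eq_zero (δ ξ : ℝ) (f : Lp ℝ 2 (volume.restrict Ω))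
    {z : Lp ℝ 2 (volume.restrict Ω)} (hz : z =ᵐ[volume.restrict Ω] 0) :
    nonlocalEnergy Ω K R δ ξ (fun _ => 0) (fun _ => 0) f z = 0 := by
  unfold nonlocalEnergy
  rw [boundaryPenalty_zero]
  have h1 : ∫ x in Ω, |interiorResidual Ω R δ (fun _ => 0) z x| ^ 2 = 0 := by
    refine integral_eq_zero_of_ae ?_
    filter_upwards [hz] with x hx
    have : ∫ y in Ω, scaledKernel R δ x y * (z x - z y) = 0 := by
      refine integral_eq_zero_of_ae ?_
      filter_upwards [hz] with y hy
      simp [hx, hy]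
    simp [interiorResidual_zero, this]
  have h2 : ∫ x in Ω, f x * z x = 0 := by
    refine integral_eq_zero_of_ae ?_
    filter_upwards [hz] with x hx
    simp [hx]
  have h3 : ∀ x, kernelMean Ω K δ z x = 0 := fun x => by
    refine integral_eq_zero_of_ae ?_
    filter_upwards [hz] with y hy
    simp [hy]
  rw [h1, h2]
  simp [h3]

lemma Lp.norm_sq_eq_integral {α : Type*} [MeasurableSpace α] {μ : Measure α} (u : Lp ℝ 2 μ) :
    ‖u‖ ^ 2 = ∫ x, u x ^ 2 ∂μ := by
  rw [← real_inner_self_eq_norm_sq, L2.inner_def]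
  exact integral_congr_ae (ae_of_all _ fun x => by simp [sq])

lemma Lp.integral_mul_le_norm_mul_norm {α : Type*} [MeasurableSpace α] {μ : Measure α}
    (f u : Lp ℝ 2 μ) : ∫ x, f x * u x ∂μ ≤ ‖f‖ * ‖u‖ := by
  refine le_trans (le_of_eq ?_) (real_inner_le_norm f u)
  rw [L2.inner_def]
  exact integral_congr_ae (ae_of_all _ fun x => by simp [mul_comm])

/-- Coercivity bounds every minimizer of the energy. -/
lemma norm_le_of_isMinOn {ρ' : ℝ} (hΩ : IsBoundedLipschitzDomain Ω) (hK : IsKernel K ρ)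
    (hR : IsKernel R ρ') {δ ξ c σ : ℝ} (hδ : 0 < δ) (hξ : 0 < ξ) (hc : 0 < c) (hσ : 0 < σ)
    (hlow : ∀ x y : EuclideanSpace ℝ (Fin d), ‖x - y‖ ≤ σ * δ → 1 / δ ^ d * c ≤ scaledKernel R δ x y)
    {C : ℝ} (hC : 0 ≤ C)
    (hcoer : ∀ u : EuclideanSpace ℝ (Fin d) → ℝ, Measurable u → IntegrableOn u Ω →
        ∫⁻ x in Ω, ENNReal.ofReal (u x ^ 2) ≤ ENNReal.ofReal C * (rangeEnergy Ω (σ * δ) u +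
          ∫⁻ x, ENNReal.ofReal (kernelMean Ω K δ u x ^ 2) ∂(surfaceMeasure Ω)))
    {f u : Lp ℝ 2 (volume.restrict Ω)}
    (hu : IsMinOn (nonlocalEnergy Ω K R δ ξ (fun _ => 0) (fun _ => 0) f) univ u) :
    ‖u‖ ≤ 2 * ((C * (2 / (c * σ ^ (d + 2)))) ^ 2 + 2 * C * ξ) * ‖f‖ := by
  have hfin := hΩ.isFiniteMeasure_surfaceMeasure
  have hΩt : volume Ω ≠ ∞ := hΩ.isBounded.measure_lt_top.ne
  have : IsFiniteMeasure (volume.restrict Ω) := ⟨by simpa using hΩt.lt_top⟩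
  have hum : Measurable u := (Lp.stronglyMeasurable u).measurable
  have hu2 : MemLp u 2 (volume.restrict Ω) := Lp.memLp u
  have hui : IntegrableOn u Ω := hu2.integrable (by norm_num)
  set A := 2 / (c * σ ^ (d + 2)) with hA
  have hA0 : 0 ≤ A := by positivity
  set v := interiorResidual Ω R δ (fun _ => 0) u with hv
  have hv2 : MemLp v 2 (volume.restrict Ω) := hR.memLp_interiorResidual hδ hΩt hum hu2
  set V := ∫ x in Ω, v x ^ 2
  set S := ∫ x, kernelMean Ω K δ u x ^ 2 ∂(surfaceMeasure Ω)
  have hV0 : 0 ≤ V := integral_nonneg fun x => sq_nonneg _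
  have hS0 : 0 ≤ S := integral_nonneg fun x => sq_nonneg _
  set E := ∫ x in Ω, v x * u x
  have hmin : V - 2 * (∫ x in Ω, f x * u x) + 1 / ξ * S ≤ 0 := by
    have h := hu (mem_univ 0)
    rw [mem_ofPred_eq, nonlocalEnergy_of_ae_eq_zero δ ξ f (Lp.coeFn_zero ℝ 2 _), nonlocalEnergy, boundaryPenalty_zero] at h
    simpa only [sq_abs] using h
  have hfu := Lp.integral_mul_le_norm_mul_norm f u
  have hS1 : 0 ≤ 1 / ξ * S := by positivity
  have hVle : V ≤ 2 * (‖f‖ * ‖u‖) := by linarith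
  have hSle : S ≤ ξ * (2 * (‖f‖ * ‖u‖)) := by
    have h1 : 1 / ξ * S ≤ 2 * (‖f‖ * ‖u‖) := by linarith
    rwa [one_div, inv_mul_le_iff₀ hξ] at h1
  have hG := hR.rangeEnergy_le hδ hc hσ hΩ.isOpen hΩt hlow hu2
  -- The maximum with 0 reflects the truncation by `ENNReal.ofReal`, so the sign of E need not be
  -- discussed.
  have hcoer' : ‖u‖ ^ 2 ≤ C * (max (A * E) 0 + S) := by
    have h1 := hcoer u hum hui
    rw [← ofReal_integral_eq_lintegral_ofReal hu2.integrable_sq (ae_of_all _ fun x => sq_nonneg _),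
      ← ofReal_integral_eq_lintegral_ofReal (hK.integrable_sq_kernelMean hδ hum hui)
        (ae_of_all _ fun x => sq_nonneg _), ← Lp.norm_sq_eq_integral] at h1
    have h2 : rangeEnergy Ω (σ * δ) u ≤ ENNReal.ofReal (max (A * E) 0) :=
      hG.trans (ENNReal.ofReal_le_ofReal (le_max_left _ _))
    rw [← ENNReal.ofReal_le_ofReal_iff (by positivity), ENNReal.ofReal_mul hC,
      ENNReal.ofReal_add (le_max_right _ _) hS0]
    exact h1.trans (by gcongr)
  -- Young's inequality with weights chosen so that half of ‖u‖² can be absorbed on the left.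
  have hYoung : C * max (A * E) 0 ≤ 1 / 2 * ‖u‖ ^ 2 + 1 / 2 * (C * A) ^ 2 * V := by
    have hrhs : 0 ≤ 1 / 2 * ‖u‖ ^ 2 + 1 / 2 * (C * A) ^ 2 * V := by positivity
    rw [mul_max_of_nonneg _ _ hC, mul_zero]
    refine max_le ?_ hrhs
    rw [Lp.norm_sq_eq_integral, ← mul_assoc, ← integral_const_mul, ← integral_const_mul,
      ← integral_const_mul, ← integral_add (hu2.integrable_sq.const_mul _)
        (hv2.integrable_sq.const_mul _)]
    refine integral_mono ((hu2.integrable_mul hv2).const_mul (C * A) |>.congr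
      (ae_of_all _ fun x => ?_)) ((hu2.integrable_sq.const_mul _).add
        (hv2.integrable_sq.const_mul _)) fun x => ?_
    · simp [mul_comm]
    · simp only
      nlinarith [sq_nonneg (u x - C * A * v x)]
  have hfinal : ‖u‖ ^ 2 ≤ 2 * ((C * A) ^ 2 + 2 * C * ξ) * ‖f‖ * ‖u‖ := by
    have h1 : ‖u‖ ^ 2 ≤ (C * A) ^ 2 * V + 2 * (C * S) := by nlinarith
    have h2 : (C * A) ^ 2 * V ≤ (C * A) ^ 2 * (2 * (‖f‖ * ‖u‖)) := by gcongr
    have h3 : C * S ≤ C * (ξ * (2 * (‖f‖ * ‖u‖))) := by gcongr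
    nlinarith
  rcases (norm_nonneg u).eq_or_lt with h0 | h0
  · rw [← h0]; positivity
  · rw [sq] at hfinal
    exact le_of_mul_le_mul_right hfinal h0

end

theorem mainTheorem5 (d : ℕ) (hd : 1 ≤ d) (Ω : Set (EuclideanSpace ℝ (Fin d)))
    (hΩ : IsBoundedLipschitzDomain Ω)
    (K R : ℝ → ℝ) (rK rR : ℝ) (hrK : 0 < rK) (hrR : 0 < rR)
    (hK : IsKernel K rK) (hR : IsKernel R rR)
    (hK0 : ∃ s, 0 ≤ s ∧ K s ≠ 0) (hR0 : ∃ s, 0 ≤ s ∧ R s ≠ 0)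
    (f : Lp ℝ 2 (volume.restrict Ω))
    (δ ξ : ℕ → ℝ) (hδ : ∀ n, 0 < δ n) (hξ : ∀ n, 0 < ξ n)
    (hδ0 : Tendsto δ atTop (𝓝 0)) (hξ0 : Tendsto ξ atTop (𝓝 0)) :
    ∃ C : ℝ, 0 < C ∧ ∀ (n : ℕ) (u : Lp ℝ 2 (volume.restrict Ω)),
      IsMinOn (nonlocalEnergy Ω K R (δ n) (ξ n) (fun _ => 0) (fun _ => 0) f) univ u →
        ‖u‖ ≤ C := by
  obtain ⟨c, hc, σ, hσ, hlow⟩ := hR.exists_le_scaledKernel hR0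
  obtain ⟨C, hC, δ₀, hδ₀, hcoer⟩ := hΩ.exists_uniform_coercivity hd hK hrK hK0 hσ
  have hsmall : ∀ᶠ n in atTop, δ n < δ₀ ∧ ξ n < 1 :=
    (hδ0.eventually (gt_mem_nhds hδ₀)).and (hξ0.eventually (gt_mem_nhds one_pos))
  obtain ⟨N, hN⟩ := eventually_atTop.1 hsmall
  have hfixed : ∀ n, ∃ b : ℝ, 0 ≤ b ∧ ∀ u : Lp ℝ 2 (volume.restrict Ω),
      IsMinOn (nonlocalEnergy Ω K R (δ n) (ξ n) (fun _ => 0) (fun _ => 0) f) univ u →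
        ‖u‖ ≤ b := by
    intro n
    obtain ⟨C', hC', hcoer'⟩ :=
      hΩ.exists_coercivity hd hK hrK hK0 (mul_pos hσ (hδ n)) (hδ n)
    have hξn := hξ n
    refine ⟨2 * ((C'.toReal * (2 / (c * σ ^ (d + 2)))) ^ 2 + 2 * C'.toReal * ξ n) * ‖f‖,
      by positivity, fun u hu => ?_⟩
    refine norm_le_of_isMinOn hΩ hK hR (hδ n) (hξ n) hc hσ (hlow d (δ n) (hδ n))
      ENNReal.toReal_nonneg ?_ hu
    rwa [ENNReal.ofReal_toReal hC']
  choose b hb0 hb using hfixed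
  -- For n ≥ N the constant C is uniform and ξ_n < 1, so ξ_n is replaced by 1.
  obtain ⟨B, hB⟩ : ∃ B, B = 2 * ((C.toReal * (2 / (c * σ ^ (d + 2)))) ^ 2 + 2 * C.toReal * 1) * ‖f‖ :=
    ⟨_, rfl⟩
  have hB0 : 0 ≤ B := by rw [hB]; positivity
  have hsum0 : 0 ≤ ∑ i ∈ Finset.range N, b i := Finset.sum_nonneg fun i _ => hb0 i
  -- The sum dominates each of the finitely many exceptional bounds; the summand 1 makes the
  -- constant positive even when f = 0.
  refine ⟨B + ∑ i ∈ Finset.range N, b i + 1, by positivity, fun n u hu => ?_⟩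
  rcases lt_or_ge n N with hn | hn
  · have h1 := hb n u hu
    have h2 := Finset.single_le_sum (fun i _ => hb0 i) (Finset.mem_range.2 hn)
    linarith
  · obtain ⟨h1, h2⟩ := hN n hn
    have h3 : ‖u‖ ≤ 2 * ((C.toReal * (2 / (c * σ ^ (d + 2)))) ^ 2 + 2 * C.toReal * ξ n) * ‖f‖ := by
      refine norm_le_of_isMinOn hΩ hK hR (hδ n) (hξ n) hc hσ (hlow d (δ n) (hδ n))
        ENNReal.toReal_nonneg ?_ hu
      rw [ENNReal.ofReal_toReal hC]
      exact hcoer (δ n) (hδ n) h1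
    have h4 : 2 * ((C.toReal * (2 / (c * σ ^ (d + 2)))) ^ 2 + 2 * C.toReal * ξ n) * ‖f‖ ≤ B := by
      rw [hB]
      gcongr
    linarith
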